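/- Let $d,n\ge 1$ and $\lambda>0$. Let $X_1,\dots,X_n$ be i.i.d. random points of $\mathbb R^d$ with a density $f$. Independently of them, let $Y_1,Y_2,\dots$ be i.i.d. Mondrian processes on $\mathbb R^d$ with lifetime $\lambda d$, that is, STIT tessellations with intensity measure $\Lambda(\cdot)=\frac1d\sum_{j=1}^d\int_{\mathbb R}1_{\{\{x:x_j=t\}\in\cdot\}}\,dt$ on hyperplanes: random closed sets whose restriction to every nondegenerate box $W$ has the law of the following construction. Each cell $C$, starting with $C=W$ at time $0$, lives for an independent exponential time with parameter $\Lambda(\{H: H\cap C\ne\emptyset\})$ and is then cut in two by a random hyperplane drawn from $\Lambda$ conditioned to hit $C$; this is stopped at time $\lambda d$ and the union of all cuts is taken. Let $Z^{(m)}_x$ denote the cell of $Y_m$ that contains $x$, with volume $V(Z^{(m)}_x)$, and put $$f^{(m)}_{\lambda,n}(x)=\frac1n\sum_{i=1}^n\frac{1_{\{x\in Z^{(m)}_{X_i}\}}}{V(Z^{(m)}_{X_i})},\qquad f_{\lambda,n,M}(x)=\frac1M\sum_{m=1}^M f^{(m)}_{\lambda,n}(x),$$ and let $f_{\lambda,n,\infty}(x)=\mathbb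 E[f^{(m)}_{\lambda,n}(x)]$, where the expectation is over $Y_m$ with the data held fixed. Let $$K_0(x)=e^{-\|x\|_1}\prod_{j=1}^d h(|x_j|),\qquad h(t)=1-te^tE_1(t)\ (t>0),\quad h(0)=1,\qquad E_1(t)=\int_t^\infty\frac{e^{-s}}s\,ds .$$ Then $K_0$ is a kernel: it is nonnegative, symmetric, and $\int_{\mathbb R^d}K_0(x)\,dx=1$. For every fixed value of the data and every $x\in\mathbb R^d$, the expectation $f_{\lambda,n,\infty}(x)$ exists and equals the kernel density estimator with kernel $K_0$ and bandwidth $\lambda^{-1}$, $$f_{\lambda,n,\infty}(x)=\frac{\lambda^d}{n}\sum_{i=1}^nK_0\big(\lambda(x-X_i)\big),$$ and $f_{\lambda,n,M}$ is a random approximation of it: for every $x\in\mathbb R^d$, almost surely, $f_{\lambda,n,M}(x)\to f_{\lambda,n,\infty}(x)$ as $M\to\infty$. -/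

import Mathlib

open MeasureTheory ProbabilityTheory Filter Topology TopologicalSpace

noncomputable section

namespace Mondrian

/-! ### Random closed sets -/

/-- The Fell σ-algebra on the closed subsets of `ℝ^d`, generated by the events "hits `C`" for
`C` compact. A random closed set is a random variable with values in this measurable space. -/
instance fellMeasurableSpace (d : ℕ) : MeasurableSpace (Closeds (Fin d → ℝ)) :=
  MeasurableSpace.generateFrom
    {S | ∃ C : Set (Fin d → ℝ), IsCompact C ∧
      S = {F : Closeds (Fin d → ℝ) | ((F : Set (Fin d → ℝ)) ∩ C).Nonempty}}

/-- The closed set `F ∩ [lo, hi]`. -/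
def restrictBox {d : ℕ} (lo hi : Fin d → ℝ) (F : Closeds (Fin d → ℝ)) : Closeds (Fin d → ℝ) :=
  F ⊓ ⟨Set.Icc lo hi, isClosed_Icc⟩

/-! ### The recursive construction of the Mondrian process in a box

The intensity measure on hyperplanes is `Λ = (1/d) ∑ⱼ ∫ 1{H(eⱼ, t) ∈ ·} dt`, i.e. the direction is
uniform over the `d` coordinate vectors. All cells are boxes `∏ⱼ [loⱼ, hiⱼ]`. -/

/-- A cell of the recursive construction: a box and the time at which it is born. -/
structure Cell (d : ℕ) where
  lo : Fin d → ℝ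
  hi : Fin d → ℝ
  birth : ℝ

/-- The randomness attached to one cell: a standard exponential variable, and two uniform variables
that select the direction and the displacement of the cut. -/
abbrev Seed : Type := ℝ × unitInterval × unitInterval

/-- The law of one seed: three independent variables, `Exp(1)`, `U[0,1]` and `U[0,1]`. -/
def seedLaw : Measure Seed := (expMeasure 1).prod (volume.prod volume)

instance : IsProbabilityMeasure seedLaw := by
  have : IsProbabilityMeasure (expMeasure 1) := isProbabilityMeasure_expMeasure one_pos
  unfold seedLaw
  infer_instance

/-- `∑ⱼ (hiⱼ - loⱼ)`, the sum of the side lengths of the cell. -/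
def Cell.perimeter {d : ℕ} (c : Cell d) : ℝ := ∑ j, (c.hi j - c.lo j)

/-- `Λ([c])`, the mass of the hyperplanes that hit the cell: the hyperplanes `{x | xⱼ = t}` that do
so are those with `loⱼ ≤ t ≤ hiⱼ`. -/
def Cell.rate {d : ℕ} (c : Cell d) : ℝ := (1 / d : ℝ) * c.perimeter

/-- The time at which the cell is cut: its lifetime `ξ.1 / Λ([c])` is exponential of rate
`Λ([c])`. -/
def Cell.death {d : ℕ} (c : Cell d) (ξ : Seed) : ℝ := c.birth + ξ.1 / c.rate

/-- The cut of the cell is orthogonal to `eⱼ`. For a uniform variable `ξ.2.1` this has probability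
`(hiⱼ - loⱼ) / ∑ᵢ (hiᵢ - loᵢ)`. -/
def Cell.CutDir {d : ℕ} (c : Cell d) (ξ : Seed) (j : Fin d) : Prop :=
  ∑ i ∈ Finset.univ.filter (· < j), (c.hi i - c.lo i) ≤ (ξ.2.1 : ℝ) * c.perimeter ∧
    (ξ.2.1 : ℝ) * c.perimeter < ∑ i ∈ Finset.univ.filter (· ≤ j), (c.hi i - c.lo i)

/-- The displacement of a cut orthogonal to `eⱼ`, uniform on `[loⱼ, hiⱼ]`. -/
def Cell.cutPos {d : ℕ} (c : Cell d) (ξ : Seed) (j : Fin d) : ℝ :=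
  c.lo j + (ξ.2.2 : ℝ) * (c.hi j - c.lo j)

/-- The cut: the intersection of the cell with the random hyperplane. -/
def Cell.cut {d : ℕ} (c : Cell d) (ξ : Seed) : Set (Fin d → ℝ) :=
  {x | x ∈ Set.Icc c.lo c.hi ∧ ∃ j, c.CutDir ξ j ∧ x j = c.cutPos ξ j}

open Classical in
/-- The two cells into which a cell is cut; `false` is the lower one, `true` the upper one. -/
def Cell.child {d : ℕ} (c : Cell d) (ξ : Seed) (s : Bool) : Cell d where
  lo j := if s = true ∧ c.CutDir ξ j then c.cutPos ξ j else c.lo j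
  hi j := if s = false ∧ c.CutDir ξ j then c.cutPos ξ j else c.hi j
  birth := c.death ξ

/-- The cells of the recursive construction in the window `[lo, hi]`, indexed by finite binary
words: `s :: v` is the child of `v` on the side `s`. -/
def cellTree {d : ℕ} (lo hi : Fin d → ℝ) (ξ : List Bool → Seed) : List Bool → Cell d
  | [] => ⟨lo, hi, 0⟩
  | s :: v => (cellTree lo hi ξ v).child (ξ v) s

/-- `Y(t, W)` for the window `W = [lo, hi]`: the union of all cuts made up to time `t`. (The closure
has no effect almost surely, since only finitely many cuts are made.) -/
def windowProcess {d : ℕ} (t : ℝ) (lo hi : Fin d → ℝ) (ξ : List Bool → Seed) :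
    Closeds (Fin d → ℝ) :=
  Closeds.closure (⋃ (v : List Bool) (_ : (cellTree lo hi ξ v).death (ξ v) ≤ t),
    (cellTree lo hi ξ v).cut (ξ v))

/-- `Y` is a Mondrian process `Y(t)` on `ℝ^d` with lifetime `t`: a random closed set whose
restriction to each (nondegenerate) box `W` has the law of the recursive construction `Y(t, W)`
with independent seeds. -/
def IsMondrian {d : ℕ} {Ω : Type*} [MeasurableSpace Ω] (P : Measure Ω) (t : ℝ)
    (Y : Ω → Closeds (Fin d → ℝ)) : Prop :=
  Measurable Y ∧ ∀ lo hi : Fin d → ℝ, (∀ j, lo j < hi j) →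
    IdentDistrib (fun ω => restrictBox lo hi (Y ω)) (windowProcess t lo hi)
      P (Measure.infinitePi fun _ : List Bool => seedLaw)

/-! ### Density estimators -/

/-- The cell containing `x` of the tessellation whose cell boundaries have union `F`: the closure of
the connected component of `x` in the complement of `F`. -/
def cellAt {d : ℕ} (F : Closeds (Fin d → ℝ)) (x : Fin d → ℝ) : Set (Fin d → ℝ) :=
  closure (connectedComponentIn (F : Set (Fin d → ℝ))ᶜ x)

/-- The density estimator of a single tree, `(1/n) ∑ᵢ 1{x ∈ Z_{pᵢ}} / V(Z_{pᵢ})`, for the data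
`p₁, …, pₙ`. -/
def treeEstimator {d n : ℕ} (F : Closeds (Fin d → ℝ)) (p : Fin n → Fin d → ℝ)
    (x : Fin d → ℝ) : ℝ :=
  (1 / n : ℝ) * ∑ i, (cellAt F (p i)).indicator (fun _ => 1 / volume.real (cellAt F (p i))) x

/-- The density estimator of the forest of the first `M` trees. -/
def forestEstimator {d n : ℕ} (F : ℕ → Closeds (Fin d → ℝ)) (M : ℕ) (p : Fin n → Fin d → ℝ)
    (x : Fin d → ℝ) : ℝ :=
  (1 / M : ℝ) * ∑ m ∈ Finset.range M, treeEstimator (F m) p x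

/-- The ideal forest estimator: the expectation of the tree estimator over the tessellation `Y`,
with the data `p` held fixed. -/
def idealForestEstimator {d n : ℕ} {Ω : Type*} [MeasurableSpace Ω] (P : Measure Ω)
    (Y : Ω → Closeds (Fin d → ℝ)) (p : Fin n → Fin d → ℝ) (x : Fin d → ℝ) : ℝ :=
  ∫ ω, treeEstimator (Y ω) p x ∂P

/-- The kernel density estimator with kernel `K` and bandwidth `b` for the data `p₁, …, pₙ`. -/
def kernelDensityEstimator {d n : ℕ} (K : (Fin d → ℝ) → ℝ) (b : ℝ) (p : Fin n → Fin d → ℝ)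
    (x : Fin d → ℝ) : ℝ :=
  (1 / (n * b ^ d) : ℝ) * ∑ i, K (b⁻¹ • (x - p i))

/-- The exponential integral `E₁`. -/
def expIntegral (t : ℝ) : ℝ := ∫ s in Set.Ioi t, Real.exp (-s) / s

/-- The volume-correction factor `h(t) = 1 - t e^t E₁(t)`, for `t ≥ 0`; here `h(0) = 1`, which is
also its limit as `t ↓ 0`. -/
def volumeCorrection (t : ℝ) : ℝ := 1 - t * Real.exp t * expIntegral t

/-- `K₀(x) = e^{-‖x‖₁} ∏ⱼ h(|xⱼ|)`. -/
def K₀ {d : ℕ} (x : Fin d → ℝ) : ℝ :=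
  Real.exp (-∑ j, |x j|) * ∏ j, volumeCorrection |x j|

end Mondrian

end

/-! Everything rests on one observation about the recursive construction in a box `W`. Call the
union of the axis-parallel segments through a point `q` of `W` that join opposite faces the cross of
`q`. If `W` is cut at all by time `t`, its first cut runs orthogonally to some axis across the whole
of `W`, so it meets the cross. Hence missing the cross, missing `W`, and missing any set in between
are almost surely the same event, of probability `exp (-t Λ([W]))` (`measure_windowProcess_misses`,
`IsMondrian.ae_misses_box`). No later cut has to be analysed.

This has two consequences for the cell of a fixed point `p`. Applied to countably many boxes, it
shows that almost surely the cell is the box whose sides are given by the distances from `p` to the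
closed set along the `2d` axis directions (`HasBoxCell.cellAt_eq`). With lifetime `λ d` the exponent
is `λ` times the sum of the side lengths, so the joint survival function of these distances factors
and they are independent exponential variables of rate `λ` (`IsMondrian.map_extents`).

The expected contribution of a data point therefore factors over the coordinates into terms `E[1{-A
≤ y ≤ B} / (A + B)]` with `A`, `B` independent exponential. The substitution `s = A + B` evaluates
such a term as `λ e^{-λ|y|} h(λ|y|)` (`lintegral_intervalDensity`), which produces `K₀`. The same
representation gives `∫ K₀ = 1`, since `K₀` is an average of uniform densities. The limit `M → ∞` is
the strong law of large numbers for fixed data, carried over to random data by independence and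
Fubini. -/

noncomputable section

namespace Mondrian

/-! ### The one-dimensional kernel and the exponential integral -/

/-- The one-dimensional factor `e^{-t} h(t)` of the kernel `K₀`. -/
def kernelFactor (t : ℝ) : ℝ := Real.exp (-t) * volumeCorrection t

theorem K₀_eq_prod {d : ℕ} (x : Fin d → ℝ) : K₀ x = ∏ j, kernelFactor |x j| := by
  simp only [K₀, kernelFactor, Finset.prod_mul_distrib, ← Real.exp_sum, Finset.sum_neg_distrib]

theorem kernelFactor_eq (t : ℝ) : kernelFactor t = Real.exp (-t) - t * expIntegral t := by
  have h : Real.exp (-t) * Real.exp t = 1 := by rw [← Real.exp_add]; simp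
  simp only [kernelFactor, volumeCorrection]
  linear_combination (-t * expIntegral t) * h

theorem integrableOn_exp_div {l y : ℝ} (hl : 0 < l) (hy : 0 < y) :
    IntegrableOn (fun s => Real.exp (-l * s) / s) (Set.Ioi y) := by
  refine Integrable.mono' ((exp_neg_integrableOn_Ioi y hl).div_const y) (by
    refine Measurable.aestronglyMeasurable (by fun_prop)) ?_
  filter_upwards [ae_restrict_mem measurableSet_Ioi] with s hs
  have hs' : y < s := hs
  rw [Real.norm_of_nonneg (div_nonneg (Real.exp_pos _).le (hy.trans hs').le)]
  gcongr

theorem integral_exp_div (l y : ℝ) (hl : 0 < l) :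
    ∫ s in Set.Ioi y, Real.exp (-l * s) / s = expIntegral (l * y) := by
  have h := integral_comp_mul_left_Ioi (fun s => Real.exp (-s) / s) y hl
  rw [expIntegral, ← inv_smul_smul₀ hl.ne' (∫ s in Set.Ioi (l * y), Real.exp (-s) / s),
    smul_comm, ← h, smul_eq_mul, ← integral_const_mul]
  refine integral_congr_ae (Eventually.of_forall fun s => ?_)
  -- At `s = 0` both sides vanish, because division by zero gives zero.
  rcases eq_or_ne s 0 with rfl | hs
  · simp
  · simp only [neg_mul]; field_simp

/-- Here `s` plays the role of the length `A + B` of a cell: `l² e^{-ls}` comes from the two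
exponential densities, `1 / s` is the inverse length, and `s - y` measures the positions of the
interval that leave `y` inside. Splitting `(s - y) / s` as `1 - y / s` gives an elementary integral
and an exponential integral. -/
theorem integrableOn_exp_mul_sub_div {l y : ℝ} (hl : 0 < l) (hy : 0 ≤ y) :
    IntegrableOn (fun s => l ^ 2 * (Real.exp (-l * s) / s) * (s - y)) (Set.Ioi y) ∧
      ∫ s in Set.Ioi y, l ^ 2 * (Real.exp (-l * s) / s) * (s - y)
        = l * kernelFactor (l * y) := by
  have hexp := exp_neg_integrableOn_Ioi y hl
  have hint : IntegrableOn (fun s => y * (Real.exp (-l * s) / s)) (Set.Ioi y) := by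
    -- For `y = 0` the function `e^{-ls} / s` is not integrable near `0`, but its coefficient `y`
    -- vanishes.
    rcases hy.eq_or_lt with rfl | hy
    · simp
    · exact (integrableOn_exp_div hl hy).const_mul y
  have hcongr : Set.EqOn
      (fun s => l ^ 2 * (Real.exp (-l * s) - y * (Real.exp (-l * s) / s)))
      (fun s => l ^ 2 * (Real.exp (-l * s) / s) * (s - y)) (Set.Ioi y) := by
    intro s hs
    have : s ≠ 0 := (hy.trans_lt hs).ne'
    simp only
    field_simp
  refine ⟨IntegrableOn.congr_fun ((hexp.sub hint).const_mul _) hcongr measurableSet_Ioi, ?_⟩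
  rw [← setIntegral_congr_fun measurableSet_Ioi hcongr, integral_const_mul,
    integral_sub hexp hint, integral_const_mul, integral_exp_div l y hl, kernelFactor_eq,
    integral_exp_mul_Ioi (by linarith)]
  field_simp

/-- The preceding integral, taken with rate `1`, has a nonnegative integrand. -/
theorem kernelFactor_nonneg {t : ℝ} (ht : 0 ≤ t) : 0 ≤ kernelFactor t := by
  have h := (integrableOn_exp_mul_sub_div one_pos ht).2
  rw [one_mul, one_mul] at h
  rw [← h]
  refine setIntegral_nonneg measurableSet_Ioi fun s hs => ?_
  have hs' : t < s := hs
  have : 0 ≤ Real.exp (-1 * s) / s := div_nonneg (Real.exp_pos _).le (ht.trans hs'.le)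
  have : 0 ≤ s - t := by linarith
  positivity

theorem measurable_expIntegral : Measurable expIntegral := by
  have : expIntegral = fun t => ∫ s, Set.indicator {z : ℝ × ℝ | z.1 < z.2}
      (fun z => Real.exp (-z.2) / z.2) (t, s) := by
    funext t
    rw [expIntegral, ← integral_indicator measurableSet_Ioi]
    rfl
  rw [this]
  refine (StronglyMeasurable.integral_prod_right' (ν := volume) ?_).measurable
  refine (Measurable.indicator (by fun_prop) ?_).stronglyMeasurable
  exact measurableSet_lt measurable_fst measurable_snd

theorem measurable_kernelFactor : Measurable kernelFactor := by
  have := measurable_expIntegral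
  unfold kernelFactor volumeCorrection
  fun_prop

/-! ### Averaging the uniform density over an interval with exponential ends -/

/-- The indicator of `y ∈ [-a, b]` divided by the length of the interval `[-a, b]`. -/
def intervalDensity (y : ℝ) (z : ℝ × ℝ) : ℝ := if -z.1 ≤ y ∧ y ≤ z.2 then 1 / (z.1 + z.2) else 0

theorem measurable_uncurry_intervalDensity :
    Measurable fun w : ℝ × (ℝ × ℝ) => intervalDensity w.1 w.2 := by
  unfold intervalDensity
  refine Measurable.ite ?_ (by fun_prop) measurable_const
  exact (measurableSet_le (f := fun w : ℝ × (ℝ × ℝ) => -w.2.1) (by fun_prop)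
    measurable_fst).inter (measurableSet_le measurable_fst measurable_snd.snd)

theorem measurable_intervalDensity (y : ℝ) : Measurable (intervalDensity y) :=
  measurable_uncurry_intervalDensity.comp (measurable_const.prodMk measurable_id)

theorem lintegral_expMeasure (l : ℝ) {g : ℝ → ENNReal} (hg : Measurable g) :
    ∫⁻ a, g a ∂expMeasure l = ∫⁻ a, exponentialPDF l a * g a := by
  have hm : Measurable (exponentialPDF l) := (measurable_exponentialPDFReal l).ennreal_ofReal
  exact lintegral_withDensity_eq_lintegral_mul _ hm hg

/-- For `y ≥ 0` the constraint `-a ≤ y` is automatic. In the variables `b` and `s = a + b` the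
integrand depends on `s` alone over the region `y ≤ b ≤ s`, so integrating out `b` first leaves the
factor `s - y`. -/
theorem lintegral_intervalDensity_of_nonneg {l y : ℝ} (hl : 0 < l) (hy : 0 ≤ y) :
    ∫⁻ z, ENNReal.ofReal (intervalDensity y z) ∂(expMeasure l).prod (expMeasure l)
      = ENNReal.ofReal (l * kernelFactor (l * y)) := by
  have : IsProbabilityMeasure (expMeasure l) := isProbabilityMeasure_expMeasure hl
  have hmeas : Measurable fun z => ENNReal.ofReal (intervalDensity y z) :=
    (measurable_intervalDensity y).ennreal_ofReal
  have hm : Measurable (exponentialPDF l) := (measurable_exponentialPDFReal l).ennreal_ofReal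
  let H : ℝ × ℝ → ENNReal := Set.indicator {z | y ≤ z.1 ∧ z.1 ≤ z.2}
    fun z => ENNReal.ofReal (l ^ 2 * (Real.exp (-l * z.2) / z.2))
  have hH : Measurable H := by
    refine Measurable.indicator (by fun_prop) ?_
    exact (measurableSet_le measurable_const measurable_fst).inter
      (measurableSet_le measurable_fst measurable_snd)
  have hpt : ∀ b a : ℝ, exponentialPDF l b * (exponentialPDF l a *
      ENNReal.ofReal (intervalDensity y (a, b))) = H (b, a + b) := by
    intro b a
    simp only [H, Set.indicator, Set.mem_ofPred_eq, intervalDensity, exponentialPDF_eq]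
    by_cases hb : y ≤ b
    swap
    · simp [hb]
    by_cases ha : 0 ≤ a
    swap
    · simp [ha]
    have hb0 := hy.trans hb
    rw [if_pos hb0, if_pos ha, if_pos ⟨by linarith, hb⟩, if_pos ⟨hb, by linarith⟩,
      ← ENNReal.ofReal_mul (by positivity), ← ENNReal.ofReal_mul (by positivity)]
    congr 1
    have : Real.exp (-l * (a + b)) = Real.exp (-(l * b)) * Real.exp (-(l * a)) := by
      rw [← Real.exp_add]; ring_nf
    rw [this]
    ring
  have hlen : ∀ s : ℝ, ∫⁻ b, H (b, s) = Set.indicator (Set.Ioi y)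
      (fun s => ENNReal.ofReal (l ^ 2 * (Real.exp (-l * s) / s) * (s - y))) s := by
    intro s
    have hHs : (fun b => H (b, s)) = Set.indicator (Set.Icc y s)
        fun _ => ENNReal.ofReal (l ^ 2 * (Real.exp (-l * s) / s)) := rfl
    rw [hHs, lintegral_indicator measurableSet_Icc, setLIntegral_const, Real.volume_Icc]
    by_cases hs : y < s
    · rw [Set.indicator_of_mem (show s ∈ Set.Ioi y from hs), ← ENNReal.ofReal_mul
        (mul_nonneg (sq_nonneg l) (div_nonneg (Real.exp_pos _).le (hy.trans hs.le)))]
    · rw [Set.indicator_of_notMem (show s ∉ Set.Ioi y from hs),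
        ENNReal.ofReal_of_nonpos (p := s - y) (by linarith), mul_zero]
  have hint := integrableOn_exp_mul_sub_div hl hy
  calc ∫⁻ z, ENNReal.ofReal (intervalDensity y z) ∂(expMeasure l).prod (expMeasure l)
      = ∫⁻ b, ∫⁻ a, H (b, a + b) := by
        rw [lintegral_prod_symm _ hmeas.aemeasurable, lintegral_expMeasure l
          hmeas.lintegral_prod_left']
        refine lintegral_congr fun b => ?_
        have hb : Measurable fun a => ENNReal.ofReal (intervalDensity y (a, b)) :=
          hmeas.comp (measurable_id.prodMk measurable_const)
        rw [lintegral_expMeasure l hb, ← lintegral_const_mul _ (by fun_prop)]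
        exact lintegral_congr fun a => hpt b a
    _ = ∫⁻ b, ∫⁻ s, H (b, s) :=
        lintegral_congr fun b => lintegral_add_right_eq_self (fun s => H (b, s)) b
    _ = ∫⁻ s, ∫⁻ b, H (b, s) := lintegral_lintegral_swap hH.aemeasurable
    _ = ∫⁻ s in Set.Ioi y, ENNReal.ofReal (l ^ 2 * (Real.exp (-l * s) / s) * (s - y)) := by
        rw [lintegral_congr hlen, lintegral_indicator measurableSet_Ioi]
    _ = ENNReal.ofReal (l * kernelFactor (l * y)) := by
        rw [← hint.2, ofReal_integral_eq_lintegral_ofReal hint.1]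
        filter_upwards [ae_restrict_mem measurableSet_Ioi] with s hs
        have hs' : y < s := hs
        have : 0 ≤ Real.exp (-l * s) / s := div_nonneg (Real.exp_pos _).le (hy.trans hs'.le)
        have : 0 ≤ s - y := by linarith
        simp only [Pi.zero_apply]
        positivity

/-- Reflecting the interval exchanges its two ends, which have the same law; this reduces negative
`y` to positive `y`. -/
theorem lintegral_intervalDensity {l : ℝ} (hl : 0 < l) (y : ℝ) :
    ∫⁻ z, ENNReal.ofReal (intervalDensity y z) ∂(expMeasure l).prod (expMeasure l)
      = ENNReal.ofReal (l * kernelFactor |l * y|) := by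
  have : IsProbabilityMeasure (expMeasure l) := isProbabilityMeasure_expMeasure hl
  rw [abs_mul, abs_of_pos hl]
  rcases le_total 0 y with hy | hy
  · rw [abs_of_nonneg hy, lintegral_intervalDensity_of_nonneg hl hy]
  · rw [abs_of_nonpos hy, ← lintegral_intervalDensity_of_nonneg hl (neg_nonneg.2 hy),
      ← lintegral_prod_swap]
    refine lintegral_congr fun z => ?_
    simp only [intervalDensity, Prod.fst_swap, Prod.snd_swap, add_comm z.1 z.2]
    congr 1
    refine if_congr ?_ rfl rfl
    constructor <;> rintro ⟨h1, h2⟩ <;> constructor <;> linarith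

theorem ae_nonneg_expMeasure (l : ℝ) : ∀ᵐ a ∂expMeasure l, 0 ≤ a := by
  rw [ae_iff, expMeasure, gammaMeasure, withDensity_apply' _]
  have : {a : ℝ | ¬0 ≤ a} = Set.Iio 0 := by ext; simp
  rw [this]
  exact lintegral_exponentialPDF_of_nonpos le_rfl

theorem expMeasure_Ioi {l : ℝ} (hl : 0 < l) {a : ℝ} (ha : 0 ≤ a) :
    expMeasure l (Set.Ioi a) = ENNReal.ofReal (Real.exp (-(l * a))) := by
  have : IsProbabilityMeasure (expMeasure l) := isProbabilityMeasure_expMeasure hl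
  have h := cdf_expMeasure_eq hl a
  rw [if_pos ha, cdf_eq_real] at h
  rw [← Set.compl_Iic, ← ofReal_measureReal, measureReal_compl measurableSet_Iic, h]
  simp

theorem ae_pos_expMeasure {l : ℝ} (hl : 0 < l) : ∀ᵐ a ∂expMeasure l, 0 < a := by
  have : IsProbabilityMeasure (expMeasure l) := isProbabilityMeasure_expMeasure hl
  have h := expMeasure_Ioi hl le_rfl
  rw [mul_zero, neg_zero, Real.exp_zero, ENNReal.ofReal_one] at h
  exact (prob_compl_eq_zero_iff measurableSet_Ioi).2 h

theorem ae_pos_expMeasure_prod {l : ℝ} (hl : 0 < l) :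
    ∀ᵐ z ∂(expMeasure l).prod (expMeasure l), 0 < z.1 ∧ 0 < z.2 := by
  have : IsProbabilityMeasure (expMeasure l) := isProbabilityMeasure_expMeasure hl
  exact (Measure.quasiMeasurePreserving_fst.ae (ae_pos_expMeasure hl)).and
    (Measure.quasiMeasurePreserving_snd.ae (ae_pos_expMeasure hl))

theorem intervalDensity_nonneg {y : ℝ} {z : ℝ × ℝ} (hz : 0 < z.1 ∧ 0 < z.2) :
    0 ≤ intervalDensity y z := by
  unfold intervalDensity
  have := hz.1
  have := hz.2
  split_ifs <;> positivity

theorem integrable_intervalDensity {l : ℝ} (hl : 0 < l) (y : ℝ) :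
    Integrable (intervalDensity y) ((expMeasure l).prod (expMeasure l)) ∧
      ∫ z, intervalDensity y z ∂(expMeasure l).prod (expMeasure l)
        = l * kernelFactor |l * y| := by
  have hnn : 0 ≤ᵐ[(expMeasure l).prod (expMeasure l)] intervalDensity y := by
    filter_upwards [ae_pos_expMeasure_prod hl] with z hz using intervalDensity_nonneg hz
  have hm := (measurable_intervalDensity y).aestronglyMeasurable
    (μ := (expMeasure l).prod (expMeasure l))
  constructor
  · refine ⟨hm, ?_⟩
    rw [hasFiniteIntegral_iff_ofReal hnn, lintegral_intervalDensity hl]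
    exact ENNReal.ofReal_lt_top
  · rw [integral_eq_lintegral_of_nonneg_ae hnn hm, lintegral_intervalDensity hl,
      ENNReal.toReal_ofReal (mul_nonneg hl.le (kernelFactor_nonneg (abs_nonneg _)))]

/-- By Tonelli, since `kernelFactor |y|` is an average over random intervals of uniform densities,
each of which integrates to `1` in `y`. -/
theorem integrable_kernelFactor_abs :
    Integrable (fun y : ℝ => kernelFactor |y|) ∧ ∫ y : ℝ, kernelFactor |y| = 1 := by
  have : IsProbabilityMeasure (expMeasure 1) := isProbabilityMeasure_expMeasure one_pos
  have hnn : 0 ≤ᵐ[volume] fun y : ℝ => kernelFactor |y| :=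
    Eventually.of_forall fun y => kernelFactor_nonneg (abs_nonneg y)
  have hm : AEStronglyMeasurable (fun y : ℝ => kernelFactor |y|) volume :=
    (measurable_kernelFactor.comp measurable_norm).aestronglyMeasurable
  have hl : ∫⁻ y : ℝ, ENNReal.ofReal (kernelFactor |y|) = 1 := by
    have h1 : ∀ y : ℝ, ENNReal.ofReal (kernelFactor |y|) = ∫⁻ z, ENNReal.ofReal
        (intervalDensity y z) ∂(expMeasure 1).prod (expMeasure 1) := fun y => by
      rw [lintegral_intervalDensity one_pos, one_mul, one_mul]
    rw [lintegral_congr h1, lintegral_lintegral_swap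
      measurable_uncurry_intervalDensity.ennreal_ofReal.aemeasurable]
    have h2 : ∀ᵐ z ∂(expMeasure 1).prod (expMeasure 1),
        ∫⁻ y, ENNReal.ofReal (intervalDensity y z) = 1 := by
      filter_upwards [ae_pos_expMeasure_prod one_pos] with z hz
      have hpos : 0 < z.1 + z.2 := add_pos hz.1 hz.2
      have : (fun y => ENNReal.ofReal (intervalDensity y z)) =
          Set.indicator (Set.Icc (-z.1) z.2) fun _ => ENNReal.ofReal (1 / (z.1 + z.2)) := by
        funext y
        simp only [intervalDensity, Set.indicator, Set.mem_Icc]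
        split_ifs <;> simp
      rw [this, lintegral_indicator measurableSet_Icc, setLIntegral_const, Real.volume_Icc,
        ← ENNReal.ofReal_mul (by positivity), show z.2 - -z.1 = z.1 + z.2 by ring,
        one_div_mul_cancel hpos.ne', ENNReal.ofReal_one]
    rw [lintegral_congr_ae h2]
    simp
  constructor
  · refine ⟨hm, ?_⟩
    rw [hasFiniteIntegral_iff_ofReal hnn, hl]
    exact ENNReal.one_lt_top
  · rw [integral_eq_lintegral_of_nonneg_ae hnn hm, hl, ENNReal.toReal_one]

/-! ### The product kernel -/

theorem K₀_nonneg {d : ℕ} (x : Fin d → ℝ) : 0 ≤ K₀ x := by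
  rw [K₀_eq_prod]
  exact Finset.prod_nonneg fun j _ => kernelFactor_nonneg (abs_nonneg _)

theorem K₀_neg {d : ℕ} (x : Fin d → ℝ) : K₀ (-x) = K₀ x := by
  simp [K₀]

theorem integrable_K₀ (d : ℕ) :
    Integrable (K₀ : (Fin d → ℝ) → ℝ) ∧ ∫ x : Fin d → ℝ, K₀ x = 1 := by
  have h : (K₀ : (Fin d → ℝ) → ℝ) = fun x => ∏ j, (fun y : ℝ => kernelFactor |y|) (x j) :=
    funext K₀_eq_prod
  rw [h]
  constructor
  · exact Integrable.fintype_prod (μ := fun _ : Fin d => volume)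
      (f := fun _ y => kernelFactor |y|) fun _ => integrable_kernelFactor_abs.1
  · rw [integral_fintype_prod_volume_eq_pow (fun y : ℝ => kernelFactor |y|),
      integrable_kernelFactor_abs.2, one_pow]

theorem measurable_K₀ (d : ℕ) : Measurable (K₀ : (Fin d → ℝ) → ℝ) := by
  have h : (K₀ : (Fin d → ℝ) → ℝ) = fun x => ∏ j, kernelFactor |x j| := funext K₀_eq_prod
  rw [h]
  refine Finset.measurable_prod _ fun j _ => measurable_kernelFactor.comp ?_
  exact measurable_norm.comp (measurable_pi_apply j)

/-! ### Deterministic geometry: closed sets for which the cell of a point is a box -/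

/-- The union of the segments through `q` that are parallel to the axes and join opposite faces of
the box `[lo, hi]`. -/
def axisCross {d : ℕ} (q lo hi : Fin d → ℝ) : Set (Fin d → ℝ) :=
  ⋃ j, (fun s => Function.update q j s) '' Set.Icc (lo j) (hi j)

/-- The distance from `p` to `F` along the ray of direction `σ • eⱼ`. -/
def rayDist {d : ℕ} (F : Closeds (Fin d → ℝ)) (p : Fin d → ℝ) (j : Fin d) (σ : ℝ) : ℝ :=
  sInf {a : ℝ | 0 ≤ a ∧ p + Pi.single j (σ * a) ∈ F}

/-- Both distances from `p` to `F` along the axes. -/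
def extents {d : ℕ} (F : Closeds (Fin d → ℝ)) (p : Fin d → ℝ) (j : Fin d) : ℝ × ℝ :=
  (rayDist F p j (-1), rayDist F p j 1)

/-- Conditions on `F` which ensure that the cell of `p` is a bounded box: `F` avoids `p`, all rays
from `p` along the axes hit `F`, and each box that meets `F` (with vertices at rational positions
relative to `p`) meets it on each of its crosses. -/
structure HasBoxCell {d : ℕ} (F : Closeds (Fin d → ℝ)) (p : Fin d → ℝ) : Prop where
  notMem : p ∉ F
  ray : ∀ j, ∀ σ ∈ ({-1, 1} : Set ℝ), ∃ a : ℝ, 0 ≤ a ∧ p + Pi.single j (σ * a) ∈ F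
  cross : ∀ q lo hi : Fin d → ℚ, (∀ j, lo j < hi j) → (∀ j, lo j ≤ q j) → (∀ j, q j ≤ hi j) →
    (∀ y ∈ axisCross (fun j => (q j : ℝ)) (fun j => (lo j : ℝ)) (fun j => (hi j : ℝ)),
      p + y ∉ F) →
    ∀ y ∈ Set.Icc (fun j => (lo j : ℝ)) (fun j => (hi j : ℝ)), p + y ∉ F

theorem isCompact_axisCross {d : ℕ} (q lo hi : Fin d → ℝ) : IsCompact (axisCross q lo hi) :=
  isCompact_iUnion fun j => isCompact_Icc.image (continuous_const.update j continuous_id)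

theorem axisCross_subset_Icc {d : ℕ} {q lo hi : Fin d → ℝ} (hlo : lo ≤ q) (hhi : q ≤ hi) :
    axisCross q lo hi ⊆ Set.Icc lo hi := by
  rintro y hy
  obtain ⟨j, s, hs, rfl⟩ := Set.mem_iUnion.1 hy
  constructor <;> intro i <;> rcases eq_or_ne i j with rfl | hij
  · simpa using hs.1
  · simpa [hij] using hlo i
  · simpa using hs.2
  · simpa [hij] using hhi i

section RayDist

variable {d : ℕ} {F : Closeds (Fin d → ℝ)} {p : Fin d → ℝ} {j : Fin d} {σ : ℝ}

theorem rayDist_nonneg : 0 ≤ rayDist F p j σ := Real.sInf_nonneg fun _ h => h.1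

theorem add_single_rayDist_mem (h : ∃ a : ℝ, 0 ≤ a ∧ p + Pi.single j (σ * a) ∈ F) :
    p + Pi.single j (σ * rayDist F p j σ) ∈ F := by
  have hcl : IsClosed {a : ℝ | 0 ≤ a ∧ p + Pi.single j (σ * a) ∈ F} := by
    refine isClosed_Ici.inter (F.isClosed.preimage ?_)
    have : Continuous fun x : ℝ => (Pi.single j x : Fin d → ℝ) :=
      continuous_single (A := fun _ => ℝ) j
    fun_prop
  exact (hcl.csInf_mem h ⟨0, fun _ h => h.1⟩).2

theorem notMem_of_lt_rayDist {a : ℝ} (ha : 0 ≤ a) (h : a < rayDist F p j σ) :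
    p + Pi.single j (σ * a) ∉ F :=
  fun hmem => notMem_of_lt_csInf h ⟨0, fun _ h => h.1⟩ ⟨ha, hmem⟩

theorem lt_rayDist_iff (h : ∃ a : ℝ, 0 ≤ a ∧ p + Pi.single j (σ * a) ∈ F) {a : ℝ} :
    a < rayDist F p j σ ↔ ∀ s ∈ Set.Icc 0 a, p + Pi.single j (σ * s) ∉ F := by
  refine ⟨fun hlt s hs => notMem_of_lt_rayDist hs.1 (hs.2.trans_lt hlt), fun hs => ?_⟩
  by_contra! hle
  exact hs _ ⟨rayDist_nonneg, hle⟩ (add_single_rayDist_mem h)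

end RayDist

/-- Supplies the side, in the direction of a face, of the box used in `HasBoxCell.mem_of_face`: it
reaches past the face at `c`, yet leaves the open extents only within `ε` of `c`. -/
theorem exists_rat_interval {A B c q ε : ℝ} (hA : 0 < A) (hB : 0 < B) (hq : -A < q ∧ q < B)
    (hc : c = -A ∨ c = B) (hε : 0 < ε) :
    ∃ l h : ℚ, l < h ∧ ((l : ℝ) < q ∧ q < h) ∧ ((l : ℝ) < 0 ∧ (0 : ℝ) < h) ∧
      ((l : ℝ) < c ∧ c < h) ∧ ∀ s ∈ Set.Icc (l : ℝ) h, (-A < s ∧ s < B) ∨ |s - c| < ε := by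
  have key : ∀ l' h' : ℝ, l' < q → q < h' → l' < 0 → 0 < h' → l' < c → c < h' →
      (∀ s, l' < s → s < h' → (-A < s ∧ s < B) ∨ |s - c| < ε) → ∃ l h : ℚ, l < h ∧
      ((l : ℝ) < q ∧ q < h) ∧ ((l : ℝ) < 0 ∧ (0 : ℝ) < h) ∧
      ((l : ℝ) < c ∧ c < h) ∧ ∀ s ∈ Set.Icc (l : ℝ) h, (-A < s ∧ s < B) ∨ |s - c| < ε := by
    intro l' h' h1 h2 h3 h4 h5 h6 h7
    obtain ⟨l, hl, hl'⟩ := exists_rat_btwn (show l' < min q (min 0 c) by simp [*])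
    obtain ⟨h, hh, hh'⟩ := exists_rat_btwn (show max q (max 0 c) < h' by simp [*])
    simp only [lt_min_iff, max_lt_iff] at hl' hh
    refine ⟨l, h, ?_, ⟨hl'.1, hh.1⟩, ⟨hl'.2.1, hh.2.1⟩, ⟨hl'.2.2, hh.2.2⟩, fun s hs =>
      h7 s (hl.trans_le hs.1) (hs.2.trans_lt hh')⟩
    exact_mod_cast hl'.1.trans hh.1
  rcases hc with rfl | rfl
  · refine key (-A - ε) B (by linarith [hq.1]) hq.2 (by linarith) hB (by linarith) (by linarith)
      fun s h1 h2 => ?_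
    rcases lt_or_ge (-A) s with h | h
    · exact Or.inl ⟨h, h2⟩
    · exact Or.inr (abs_lt.2 ⟨by linarith, by linarith⟩)
  · refine key (-A) (c + ε) hq.1 (by linarith [hq.2]) (by linarith) (by linarith) (by linarith)
      (by linarith) fun s h1 h2 => ?_
    rcases lt_or_ge s c with h | h
    · exact Or.inl ⟨h1, h⟩
    · exact Or.inr (abs_lt.2 ⟨by linarith, by linarith⟩)

namespace HasBoxCell

variable {d : ℕ} {F : Closeds (Fin d → ℝ)} {p : Fin d → ℝ}

theorem rayDist_pos (h : HasBoxCell F p) (j : Fin d) {σ : ℝ} (hσ : σ ∈ ({-1, 1} : Set ℝ)) :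
    0 < rayDist F p j σ := by
  refine rayDist_nonneg.lt_of_ne fun h0 => h.notMem ?_
  simpa [← h0] using add_single_rayDist_mem (h.ray j σ hσ)

theorem fst_extents_pos (h : HasBoxCell F p) (j : Fin d) : 0 < (extents F p j).1 :=
  h.rayDist_pos j (by simp)

theorem snd_extents_pos (h : HasBoxCell F p) (j : Fin d) : 0 < (extents F p j).2 :=
  h.rayDist_pos j (by simp)

theorem notMem_of_axis {j : Fin d} {s : ℝ} (h1 : -(extents F p j).1 < s)
    (h2 : s < (extents F p j).2) : p + Pi.single j s ∉ F := by
  rcases le_total 0 s with hs | hs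
  · simpa using notMem_of_lt_rayDist hs h2
  · simpa using notMem_of_lt_rayDist (σ := -1) (neg_nonneg.2 hs)
      (show -s < rayDist F p j (-1) by simp only [extents] at h1; linarith)

/-- A rational box strictly inside the extents and containing `0` and `y` has its cross through `0`
on the axes, where `F` is missed by definition of the extents. The cross condition spreads this to
the whole box. -/
theorem notMem_of_interior (h : HasBoxCell F p) {y : Fin d → ℝ}
    (h1 : ∀ j, -(extents F p j).1 < y j) (h2 : ∀ j, y j < (extents F p j).2) : p + y ∉ F := by
  have hlo : ∀ j, ∃ l : ℚ, -(extents F p j).1 < l ∧ (l : ℝ) < min (y j) 0 := fun j =>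
    exists_rat_btwn (by simp [h1 j, h.fst_extents_pos j])
  have hhi : ∀ j, ∃ l : ℚ, max (y j) 0 < (l : ℝ) ∧ (l : ℝ) < (extents F p j).2 := fun j =>
    exists_rat_btwn (by simp [h2 j, h.snd_extents_pos j])
  choose lo hlo hlo' using hlo
  choose hi hhi hhi' using hhi
  simp only [lt_min_iff, max_lt_iff] at hlo' hhi
  refine h.cross 0 lo hi (fun j => ?_) (fun j => ?_) (fun j => ?_) ?_ y
    ⟨fun j => (hlo' j).1.le, fun j => (hhi j).1.le⟩
  · exact_mod_cast (hlo' j).1.trans (hhi j).1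
  · exact_mod_cast (hlo' j).2.le
  · exact_mod_cast (hhi j).2.le
  · intro z hz
    obtain ⟨j, s, hs, rfl⟩ := Set.mem_iUnion.1 hz
    have h0 : (fun j => (((0 : Fin d → ℚ) j : ℚ) : ℝ)) = 0 := by funext; simp
    simp only [h0]
    exact notMem_of_axis ((hlo j).trans_le hs.1) (hs.2.trans_lt (hhi' j))

/-- If a face point `y` were missed, so would be a ball around it. Take a rational `q` in this ball
and in the open box of the extents, and a box that protrudes through the face in direction `j`. The
arms of the cross at `q` stay in the open box, except that the arm along `eⱼ` may leave it, but only
inside the ball. So the protruding box would miss `F`, although it contains the point where the axis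
through `p` first hits `F`. -/
theorem mem_of_face (h : HasBoxCell F p) {j : Fin d} {y : Fin d → ℝ}
    (h1 : ∀ i, -(extents F p i).1 ≤ y i) (h2 : ∀ i, y i ≤ (extents F p i).2)
    (hy : y j = -(extents F p j).1 ∨ y j = (extents F p j).2) : p + y ∈ F := by
  by_contra hmem
  have hA := h.fst_extents_pos
  have hB := h.snd_extents_pos
  have hopen : IsOpen {z : Fin d → ℝ | p + z ∉ F} :=
    F.isClosed.isOpen_compl.preimage (continuous_const.add continuous_id)
  obtain ⟨ε, hε, hball⟩ := Metric.isOpen_iff.1 hopen y hmem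
  have hq : ∀ i, ∃ q : ℚ, max (-(extents F p i).1) (y i - ε) < q ∧
      (q : ℝ) < min (extents F p i).2 (y i + ε) := fun i => exists_rat_btwn (by
    have := h1 i
    have := h2 i
    have := hA i
    have := hB i
    simp only [lt_min_iff, max_lt_iff]
    refine ⟨⟨?_, ?_⟩, ?_, ?_⟩ <;> linarith)
  choose q hq hq' using hq
  simp only [lt_min_iff, max_lt_iff] at hq hq'
  obtain ⟨l, r, hlr, hlq, hl0, hlc, hs⟩ :=
    exists_rat_interval (hA j) (hB j) ⟨(hq j).1, (hq' j).1⟩ hy hε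
  have hlo : ∀ i, ∃ l : ℚ, -(extents F p i).1 < l ∧ (l : ℝ) < min (q i : ℝ) 0 := fun i =>
    exists_rat_btwn (by simp [(hq i).1, hA i])
  have hhi : ∀ i, ∃ l : ℚ, max (q i : ℝ) 0 < (l : ℝ) ∧ (l : ℝ) < (extents F p i).2 := fun i =>
    exists_rat_btwn (by simp [(hq' i).1, hB i])
  choose lo hlo hlo' using hlo
  choose hi hhi hhi' using hhi
  simp only [lt_min_iff, max_lt_iff] at hlo' hhi
  have hface : p + Pi.single j (y j) ∈ F := by
    rcases hy with hy | hy
    · rw [hy]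
      simpa [extents] using add_single_rayDist_mem (h.ray j (-1) (by simp))
    · rw [hy]
      simpa [extents] using add_single_rayDist_mem (h.ray j 1 (by simp))
  refine h.cross q (Function.update lo j l) (Function.update hi j r) (fun i => ?_) (fun i => ?_)
    (fun i => ?_) ?_ (Pi.single j (y j)) ⟨fun i => ?_, fun i => ?_⟩ hface
  · rcases eq_or_ne i j with rfl | hij
    · simpa using hlr
    · simp only [Function.update_of_ne hij]
      exact_mod_cast (hlo' i).1.trans (hhi i).1
  · rcases eq_or_ne i j with rfl | hij
    · simpa using (by exact_mod_cast hlq.1.le : l ≤ q i)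
    · simp only [Function.update_of_ne hij]
      exact_mod_cast (hlo' i).1.le
  · rcases eq_or_ne i j with rfl | hij
    · simpa using (by exact_mod_cast hlq.2.le : q i ≤ r)
    · simp only [Function.update_of_ne hij]
      exact_mod_cast (hhi i).1.le
  · intro z hz
    obtain ⟨i, s, hsi, rfl⟩ := Set.mem_iUnion.1 hz
    have hin : (-(extents F p i).1 < s ∧ s < (extents F p i).2) →
        p + Function.update (fun k => (q k : ℝ)) i s ∉ F := by
      intro hs'
      refine h.notMem_of_interior (fun k => ?_) (fun k => ?_) <;>
        rcases eq_or_ne k i with rfl | hki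
      · simpa using hs'.1
      · simpa [hki] using (hq k).1
      · simpa using hs'.2
      · simpa [hki] using (hq' k).1
    rcases eq_or_ne i j with rfl | hij
    · simp only [Function.update_self] at hsi
      rcases hs s hsi with hs' | hs'
      · exact hin hs'
      · refine hball ?_
        rw [Metric.mem_ball, dist_pi_lt_iff hε]
        intro k
        rcases eq_or_ne k i with rfl | hki
        · simpa [Real.dist_eq] using hs'
        · simp only [Function.update_of_ne hki, Real.dist_eq, abs_lt]
          exact ⟨by linarith [(hq k).2], by linarith [(hq' k).2]⟩
    · simp only [Function.update_of_ne hij] at hsi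
      exact hin ⟨(hlo i).trans_le hsi.1, hsi.2.trans_lt (hhi' i)⟩
  · rcases eq_or_ne i j with rfl | hij
    · simpa using hlc.1.le
    · simpa [hij] using (hlo' i).2.le
  · rcases eq_or_ne i j with rfl | hij
    · simpa using hlc.2.le
    · simpa [hij] using (hhi i).2.le

theorem cellAt_eq (h : HasBoxCell F p) :
    cellAt F p = Set.univ.pi fun j => Set.Icc (p j - (extents F p j).1) (p j + (extents F p j).2) := by
  set U : Set (Fin d → ℝ) :=
    Set.univ.pi fun j => Set.Ioo (p j - (extents F p j).1) (p j + (extents F p j).2) with hU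
  have hcl : closure U =
      Set.univ.pi fun j => Set.Icc (p j - (extents F p j).1) (p j + (extents F p j).2) := by
    rw [hU, closure_pi_set]
    congr 1
    funext j
    exact closure_Ioo (by linarith [h.fst_extents_pos j, h.snd_extents_pos j])
  have hopen : IsOpen U := isOpen_set_pi Set.finite_univ fun _ _ => isOpen_Ioo
  have hpU : p ∈ U := fun j _ =>
    ⟨by linarith [h.fst_extents_pos j], by linarith [h.snd_extents_pos j]⟩
  have hUF : U ⊆ (F : Set (Fin d → ℝ))ᶜ := by
    intro z hz
    have := h.notMem_of_interior (y := z - p) (fun j => by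
      linarith [(hz j trivial).1, Pi.sub_apply z p j]) (fun j => by
      linarith [(hz j trivial).2, Pi.sub_apply z p j])
    rwa [add_sub_cancel] at this
  have hcompU : connectedComponentIn (F : Set (Fin d → ℝ))ᶜ p = U := by
    apply Set.Subset.antisymm
    -- The boundary of `U` lies in `F`, so the component is covered by the disjoint open sets `U`
    -- and the complement of `closure U`; being connected, it stays in `U`.
    · refine isPreconnected_connectedComponentIn.subset_left_of_subset_union hopen
        isClosed_closure.isOpen_compl (Set.disjoint_compl_right_iff_subset.2 subset_closure) ?_
        ⟨p, mem_connectedComponentIn h.notMem, hpU⟩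
      intro z hz
      by_contra hzU
      simp only [Set.mem_union, Set.mem_compl_iff, not_or, not_not] at hzU
      obtain ⟨hz1, hz2⟩ := hzU
      rw [hcl] at hz2
      simp only [hU, Set.mem_pi, Set.mem_univ, true_implies, not_forall] at hz1
      obtain ⟨j, hj⟩ := hz1
      refine connectedComponentIn_subset _ _ hz ?_
      have := h.mem_of_face (j := j) (y := z - p)
        (fun i => by linarith [(hz2 i trivial).1, Pi.sub_apply z p i])
        (fun i => by linarith [(hz2 i trivial).2, Pi.sub_apply z p i]) (by
          by_contra! hne
          refine hj ⟨(hz2 j trivial).1.lt_of_ne fun h' => hne.1 ?_,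
            (hz2 j trivial).2.lt_of_ne fun h' => hne.2 ?_⟩ <;>
          · rw [Pi.sub_apply]
            linarith)
      rwa [add_sub_cancel] at this
    · exact (isPreconnected_univ_pi fun j => isPreconnected_Ioo).subset_connectedComponentIn hpU hUF
  rw [cellAt, hcompU, hcl]

theorem indicator_cellAt (h : HasBoxCell F p) (x : Fin d → ℝ) :
    (cellAt F p).indicator (fun _ => 1 / volume.real (cellAt F p)) x
      = ∏ j, intervalDensity (x j - p j) (extents F p j) := by
  have hvol : volume.real (cellAt F p) = ∏ j, ((extents F p j).1 + (extents F p j).2) := by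
    rw [h.cellAt_eq, Set.pi_univ_Icc, Measure.real, Real.volume_Icc_pi_toReal]
    · exact Finset.prod_congr rfl fun j _ => by ring
    · exact fun j => by linarith [h.fst_extents_pos j, h.snd_extents_pos j]
  by_cases hx : x ∈ cellAt F p
  · rw [Set.indicator_of_mem hx, hvol, one_div, ← Finset.prod_inv_distrib]
    rw [h.cellAt_eq] at hx
    refine Finset.prod_congr rfl fun j _ => ?_
    rw [intervalDensity, if_pos ⟨by linarith [(hx j trivial).1], by linarith [(hx j trivial).2]⟩,
      one_div]
  · rw [Set.indicator_of_notMem hx]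
    rw [h.cellAt_eq] at hx
    simp only [Set.mem_pi, Set.mem_univ, true_implies, not_forall] at hx
    obtain ⟨j, hj⟩ := hx
    symm
    refine Finset.prod_eq_zero (Finset.mem_univ j) (if_neg fun h' => hj ?_)
    exact ⟨by linarith [h'.1], by linarith [h'.2]⟩

end HasBoxCell

/-! ### The first cut and the probability of missing a cross -/

/-- The direction is the least `j` whose partial sum of side lengths exceeds the uniform level; the
strict bound `ξ.2.1 < 1` guarantees that the full sum exceeds it. -/
theorem Cell.exists_cutDir {d : ℕ} (c : Cell d) (ξ : Seed) (hc : 0 < c.perimeter)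
    (hξ : (ξ.2.1 : ℝ) < 1) : ∃ j, c.CutDir ξ j := by
  classical
  have hlast : ∃ j, (ξ.2.1 : ℝ) * c.perimeter
      < ∑ i ∈ Finset.univ.filter (· ≤ j), (c.hi i - c.lo i) := by
    cases d with
    | zero => simp [Cell.perimeter] at hc
    | succ d =>
      refine ⟨Fin.last d, ?_⟩
      rw [Finset.filter_true_of_mem fun i _ => Fin.le_last i]
      exact mul_lt_of_lt_one_left hc hξ
  obtain ⟨j, hj, hmin⟩ := WellFounded.has_min (wellFounded_lt (α := Fin d))
    {j | (ξ.2.1 : ℝ) * c.perimeter < ∑ i ∈ Finset.univ.filter (· ≤ j), (c.hi i - c.lo i)} hlast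
  refine ⟨j, ?_, hj⟩
  obtain ⟨j, hjd⟩ := j
  cases j with
  | zero =>
    rw [Finset.filter_false_of_mem, Finset.sum_empty]
    · exact mul_nonneg ξ.2.1.2.1 hc.le
    · intro i _ hi
      exact absurd (Fin.lt_def.1 hi) (Nat.not_lt_zero _)
  | succ k =>
    have hk := hmin ⟨k, by omega⟩
    have heq : Finset.univ.filter (fun i : Fin d => i < ⟨k + 1, hjd⟩)
        = Finset.univ.filter (fun i : Fin d => i ≤ ⟨k, by omega⟩) := by
      ext i
      simp [Fin.lt_def, Fin.le_def]
    rw [heq]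
    by_contra! hlt
    exact hk hlt (Fin.lt_def.2 (Nat.lt_succ_self k))

theorem Cell.cutPos_mem {d : ℕ} (c : Cell d) (ξ : Seed) {j : Fin d} (h : c.lo j ≤ c.hi j) :
    c.cutPos ξ j ∈ Set.Icc (c.lo j) (c.hi j) := by
  have h0 := ξ.2.2.2.1
  have h1 := ξ.2.2.2.2
  constructor <;> simp only [Cell.cutPos] <;> nlinarith

theorem Cell.child_lo_le_hi {d : ℕ} (c : Cell d) (ξ : Seed) (s : Bool) (h : c.lo ≤ c.hi) :
    (c.child ξ s).lo ≤ (c.child ξ s).hi := by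
  intro j
  have := c.cutPos_mem ξ (h j)
  simp only [Cell.child]
  cases s <;> by_cases hj : c.CutDir ξ j <;> simp [hj, this.1, this.2, h j]

theorem Cell.rate_nonneg {d : ℕ} (c : Cell d) (h : c.lo ≤ c.hi) : 0 ≤ c.rate :=
  mul_nonneg (by positivity) (Finset.sum_nonneg fun j _ => sub_nonneg.2 (h j))

theorem cellTree_lo_le_hi {d : ℕ} {lo hi : Fin d → ℝ} (h : lo ≤ hi) (ξ : List Bool → Seed)
    (v : List Bool) : (cellTree lo hi ξ v).lo ≤ (cellTree lo hi ξ v).hi := by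
  induction v with
  | nil => exact h
  | cons s v ih => exact Cell.child_lo_le_hi _ _ _ ih

/-- Lifetimes are nonnegative, also for a degenerate cell of rate `0`, where the quotient is `0`.
Hence nothing is cut before the window itself. -/
theorem death_root_le {d : ℕ} {lo hi : Fin d → ℝ} (h : lo ≤ hi) {ξ : List Bool → Seed}
    (hξ : ∀ v, 0 ≤ (ξ v).1) (v : List Bool) :
    (cellTree lo hi ξ []).death (ξ []) ≤ (cellTree lo hi ξ v).death (ξ v) := by
  induction v with
  | nil => exact le_rfl
  | cons s v ih =>
    refine ih.trans ?_
    have := Cell.rate_nonneg _ (cellTree_lo_le_hi h ξ (s :: v))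
    have := div_nonneg (hξ (s :: v)) this
    change _ ≤ (cellTree lo hi ξ v).death (ξ v) + _
    linarith

theorem notMem_windowProcess {d : ℕ} {lo hi : Fin d → ℝ} (h : lo ≤ hi) {ξ : List Bool → Seed}
    (hξ : ∀ v, 0 ≤ (ξ v).1) {t : ℝ} (ht : t < (cellTree lo hi ξ []).death (ξ [])) (x : Fin d → ℝ) :
    x ∉ windowProcess t lo hi ξ := by
  have : ⋃ (v : List Bool) (_ : (cellTree lo hi ξ v).death (ξ v) ≤ t),
      (cellTree lo hi ξ v).cut (ξ v) = ∅ := by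
    simp only [Set.iUnion_eq_empty]
    exact fun v hv => absurd (ht.trans_le (death_root_le h hξ v)) hv.not_gt
  intro hx
  change x ∈ closure _ at hx
  rw [this, closure_empty] at hx
  exact hx

/-- The first cut, orthogonal to `eⱼ` say, spans the window and has its displacement between `lo j`
and `hi j`, so it meets the arm of the cross along `eⱼ`. -/
theorem exists_mem_axisCross_windowProcess {d : ℕ} {q lo hi : Fin d → ℝ} (hlo : lo ≤ q)
    (hhi : q ≤ hi) {ξ : List Bool → Seed} (hper : 0 < (cellTree lo hi ξ []).perimeter)
    (hξ : ((ξ []).2.1 : ℝ) < 1) {t : ℝ} (ht : (cellTree lo hi ξ []).death (ξ []) ≤ t) :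
    ∃ y ∈ axisCross q lo hi, y ∈ windowProcess t lo hi ξ := by
  obtain ⟨j, hj⟩ := Cell.exists_cutDir _ (ξ []) hper hξ
  have hpos := Cell.cutPos_mem (cellTree lo hi ξ []) (ξ []) (hlo.trans hhi j)
  have hmem : Function.update q j ((cellTree lo hi ξ []).cutPos (ξ []) j) ∈ axisCross q lo hi :=
    Set.mem_iUnion.2 ⟨j, _, hpos, rfl⟩
  refine ⟨_, hmem, subset_closure (Set.mem_iUnion₂.2 ⟨[], ht, ?_, j, hj, by simp⟩)⟩
  exact axisCross_subset_Icc hlo hhi hmem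

instance isProbabilityMeasure_expMeasure_one : IsProbabilityMeasure (expMeasure 1) :=
  isProbabilityMeasure_expMeasure one_pos

theorem ae_seedLaw : ∀ᵐ ξ ∂seedLaw, 0 ≤ ξ.1 ∧ (ξ.2.1 : ℝ) < 1 := by
  have h1 : ∀ᵐ u : unitInterval, (u : ℝ) < 1 := by
    filter_upwards [compl_mem_ae_iff.2 (measure_singleton (1 : unitInterval))] with u hu
    exact u.2.2.lt_of_ne fun h => hu (Subtype.ext h)
  refine (Measure.quasiMeasurePreserving_fst.ae (ae_nonneg_expMeasure 1)).and ?_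
  exact Measure.quasiMeasurePreserving_snd.ae (Measure.quasiMeasurePreserving_fst.ae h1)

theorem measurableSet_hits {d : ℕ} {C : Set (Fin d → ℝ)} (hC : IsCompact C) :
    MeasurableSet {F : Closeds (Fin d → ℝ) | ((F : Set (Fin d → ℝ)) ∩ C).Nonempty} :=
  MeasurableSpace.measurableSet_generateFrom ⟨C, hC, rfl⟩

/-- The window process misses any set that contains a cross of the window with probability
`exp (-t Λ([W]))`. -/
theorem measure_windowProcess_misses {d : ℕ} (hd : 0 < d) {q lo hi : Fin d → ℝ}
    (hlohi : ∀ j, lo j < hi j) (hlo : lo ≤ q) (hhi : q ≤ hi) {C : Set (Fin d → ℝ)}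
    (hC : axisCross q lo hi ⊆ C) {t : ℝ} (ht : 0 ≤ t) :
    (Measure.infinitePi fun _ : List Bool => seedLaw)
        {ξ | ¬((windowProcess t lo hi ξ : Set (Fin d → ℝ)) ∩ C).Nonempty}
      = ENNReal.ofReal (Real.exp (-(t * ((1 / d : ℝ) * ∑ j, (hi j - lo j))))) := by
  have hle : lo ≤ hi := hlo.trans hhi
  have : Nonempty (Fin d) := ⟨⟨0, hd⟩⟩
  have hper : 0 < ∑ j, (hi j - lo j) :=
    Finset.sum_pos (fun j _ => sub_pos.2 (hlohi j)) Finset.univ_nonempty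
  have hd' : (0 : ℝ) < d := by exact_mod_cast hd
  set r : ℝ := (1 / d : ℝ) * ∑ j, (hi j - lo j) with hr
  have hrpos : 0 < r := by positivity
  have hev := measurePreserving_eval_infinitePi (fun _ : List Bool => seedLaw)
  have hae : ∀ᵐ ξ ∂Measure.infinitePi fun _ : List Bool => seedLaw,
      ∀ v, 0 ≤ (ξ v).1 ∧ ((ξ v).2.1 : ℝ) < 1 :=
    ae_all_iff.2 fun v => (hev v).quasiMeasurePreserving.ae ae_seedLaw
  -- Up to null sets, missing `C` means that the root is cut after time `t`, an event of the
  -- exponential seed of the root alone.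
  have hset : {ξ | ¬((windowProcess t lo hi ξ : Set (Fin d → ℝ)) ∩ C).Nonempty}
      =ᵐ[Measure.infinitePi fun _ : List Bool => seedLaw]
        (fun ξ => ξ []) ⁻¹' (Prod.fst ⁻¹' Set.Ioi (t * r)) := by
    rw [eventuallyEq_set]
    filter_upwards [hae] with ξ hξ
    have hdeath : (cellTree lo hi ξ []).death (ξ []) = (ξ []).1 / r := zero_add _
    have hiff : t * r < (ξ []).1 ↔ t < (cellTree lo hi ξ []).death (ξ []) := by
      rw [hdeath, lt_div_iff₀ hrpos]
    change ¬ _ ↔ t * r < (ξ []).1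
    rw [hiff]
    constructor
    · intro h
      by_contra! hle'
      obtain ⟨y, hy, hy'⟩ := exists_mem_axisCross_windowProcess hlo hhi hper (hξ []).2 hle'
      exact h ⟨y, hy', hC hy⟩
    · rintro h ⟨y, hy, -⟩
      exact notMem_windowProcess hle (fun v => (hξ v).1) h y hy
  have hm : MeasurableSet (Set.Ioi (t * r)) := measurableSet_Ioi
  rw [measure_congr hset, (hev []).measure_preimage (measurable_fst hm).nullMeasurableSet]
  have hfst : MeasurePreserving Prod.fst seedLaw (expMeasure 1) := measurePreserving_fst
  rw [hfst.measure_preimage hm.nullMeasurableSet, expMeasure_Ioi one_pos (by positivity), one_mul]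

namespace IsMondrian

variable {d : ℕ} {Ω : Type*} [MeasurableSpace Ω] {P : Measure Ω} {t : ℝ}
  {Y : Ω → Closeds (Fin d → ℝ)}

theorem measure_misses (hY : IsMondrian P t Y) (hd : 0 < d) (ht : 0 ≤ t) {q lo hi : Fin d → ℝ}
    (hlohi : ∀ j, lo j < hi j) (hlo : lo ≤ q) (hhi : q ≤ hi) {C : Set (Fin d → ℝ)}
    (hC : axisCross q lo hi ⊆ C) (hC' : C ⊆ Set.Icc lo hi) (hcomp : IsCompact C) :
    P {ω | ∀ y ∈ C, y ∉ Y ω}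
      = ENNReal.ofReal (Real.exp (-(t * ((1 / d : ℝ) * ∑ j, (hi j - lo j))))) := by
  rw [← measure_windowProcess_misses hd hlohi hlo hhi hC ht]
  refine Eq.trans ?_ ((hY.2 lo hi hlohi).measure_mem_eq (measurableSet_hits hcomp).compl)
  congr 1
  ext ω
  constructor
  · rintro h ⟨y, hy, hyC⟩
    exact h y hyC hy.1
  · intro h y hyC hy
    exact h ⟨y, ⟨hy, hC' hyC⟩, hyC⟩

theorem measurableSet_misses (hY : IsMondrian P t Y) {C : Set (Fin d → ℝ)} (hC : IsCompact C) :
    MeasurableSet {ω | ∀ y ∈ C, y ∉ Y ω} := by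
  have : {ω | ∀ y ∈ C, y ∉ Y ω}
      = Y ⁻¹' {F : Closeds (Fin d → ℝ) | ((F : Set (Fin d → ℝ)) ∩ C).Nonempty}ᶜ := by
    ext ω
    constructor
    · rintro h ⟨y, hy, hyC⟩
      exact h y hyC hy
    · intro h y hyC hy
      exact h ⟨y, hy, hyC⟩
  rw [this]
  exact hY.1 (measurableSet_hits hC).compl

/-- A Mondrian process that misses a cross of a box almost surely misses the box. -/
theorem ae_misses_box (hY : IsMondrian P t Y) (hd : 0 < d) (ht : 0 ≤ t) {q lo hi : Fin d → ℝ}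
    (hlohi : ∀ j, lo j < hi j) (hlo : lo ≤ q) (hhi : q ≤ hi) :
    ∀ᵐ ω ∂P, (∀ y ∈ axisCross q lo hi, y ∉ Y ω) → ∀ y ∈ Set.Icc lo hi, y ∉ Y ω := by
  have hsub := axisCross_subset_Icc hlo hhi
  have h1 := hY.measure_misses hd ht hlohi hlo hhi subset_rfl hsub (isCompact_axisCross q lo hi)
  have h2 := hY.measure_misses hd ht hlohi hlo hhi hsub subset_rfl isCompact_Icc
  -- The two events are nested and have the same finite probability.
  have h := ae_eq_of_subset_of_measure_ge
    (show {ω | ∀ y ∈ Set.Icc lo hi, y ∉ Y ω} ⊆ {ω | ∀ y ∈ axisCross q lo hi, y ∉ Y ω} from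
      fun ω hω y hy => hω y (hsub hy)) (by rw [h1, h2])
    (hY.measurableSet_misses isCompact_Icc).nullMeasurableSet
    (by rw [h1]; exact ENNReal.ofReal_ne_top)
  filter_upwards [eventuallyEq_set.1 h] with ω hω using hω.2

end IsMondrian

/-! ### Joint measurability in the point and the closed set -/

/-- By compactness, `p + C` misses the closed set exactly when, for some `n` and some point `u k` of
a dense sequence within `1 / (n + 1)` of `p`, the translate by `u k` of the `1 / (n + 1)`-thickening
of `C` misses it. The complement is thus a countable union of measurable rectangles. -/
theorem measurableSet_exists_add_mem {d : ℕ} {C : Set (Fin d → ℝ)} (hC : IsCompact C) :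
    MeasurableSet {z : (Fin d → ℝ) × Closeds (Fin d → ℝ) | ∃ y ∈ C, z.1 + y ∈ z.2} := by
  let u := denseSeq (Fin d → ℝ)
  let K : ℕ → ℕ → Set (Fin d → ℝ) := fun n k =>
    (fun y => u k + y) '' Metric.cthickening (1 / ((n : ℝ) + 1)) C
  have hK : ∀ n k, IsCompact (K n k) := fun n k =>
    hC.cthickening.image (continuous_const.add continuous_id)
  have heq : {z : (Fin d → ℝ) × Closeds (Fin d → ℝ) | ∃ y ∈ C, z.1 + y ∈ z.2} =
      (⋃ (n : ℕ) (k : ℕ), Metric.closedBall (u k) (1 / ((n : ℝ) + 1)) ×ˢ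
        {F : Closeds (Fin d → ℝ) | ((F : Set (Fin d → ℝ)) ∩ K n k).Nonempty}ᶜ)ᶜ := by
    rw [← compl_inj_iff, compl_compl]
    ext ⟨p, F⟩
    simp only [Set.mem_iUnion, Set.mem_prod]
    constructor
    · intro h
      have hsub : (fun y => p + y) '' C ⊆ (F : Set (Fin d → ℝ))ᶜ := by
        rintro _ ⟨y, hy, rfl⟩ hmem
        exact h ⟨y, hy, hmem⟩
      obtain ⟨δ, hδ, hthick⟩ := (hC.image (continuous_const.add continuous_id)
        : IsCompact ((fun y => p + y) '' C)).exists_cthickening_subset_open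
          F.isClosed.isOpen_compl hsub
      obtain ⟨n, hn⟩ := exists_nat_one_div_lt (half_pos hδ)
      obtain ⟨k, hk⟩ := (denseRange_denseSeq (Fin d → ℝ)).exists_dist_lt p
        (show (0 : ℝ) < 1 / ((n : ℝ) + 1) by positivity)
      refine ⟨n, k, hk.le, ?_⟩
      rintro ⟨_, hyF, y, hy, rfl⟩
      rw [hC.cthickening_eq_biUnion_closedBall (by positivity)] at hy
      obtain ⟨c, hc, hyc⟩ := Set.mem_iUnion₂.1 hy
      refine hthick (Metric.mem_cthickening_of_dist_le _ (p + c) _ _ ⟨c, hc, rfl⟩ ?_) hyF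
      calc dist (u k + y) (p + c) ≤ dist (u k) p + dist y c := dist_add_add_le _ _ _ _
        _ ≤ δ := by
          have := Metric.mem_closedBall.1 hyc
          have hk' : dist p (u k) < 1 / ((n : ℝ) + 1) := hk
          rw [dist_comm] at hk'
          linarith
    · rintro ⟨n, k, hk, hmiss⟩ ⟨y, hy, hmem⟩
      refine hmiss ⟨p + y, hmem, y + (p - u k), ?_, by simp only; abel⟩
      refine Metric.mem_cthickening_of_dist_le _ y _ _ hy ?_
      rw [dist_self_add_left, ← dist_eq_norm]
      exact hk
  rw [heq]
  refine (MeasurableSet.iUnion fun n => MeasurableSet.iUnion fun k => ?_).compl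
  exact Metric.isClosed_closedBall.measurableSet.prod (measurableSet_hits (hK n k)).compl

theorem measurableSet_exists_single_mem {d : ℕ} (j : Fin d) (σ a : ℝ) :
    MeasurableSet {z : (Fin d → ℝ) × Closeds (Fin d → ℝ) |
      ∃ s ∈ Set.Icc 0 a, z.1 + Pi.single j (σ * s) ∈ z.2} := by
  have hcont : Continuous fun s : ℝ => (Pi.single j (σ * s) : Fin d → ℝ) :=
    (continuous_single (A := fun _ => ℝ) j).comp (continuous_const.mul continuous_id)
  have := measurableSet_exists_add_mem
    ((isCompact_Icc (a := (0 : ℝ)) (b := a)).image hcont)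
  simpa only [Set.exists_mem_image] using this

theorem measurableSet_exists_ray_mem {d : ℕ} (j : Fin d) (σ : ℝ) :
    MeasurableSet {z : (Fin d → ℝ) × Closeds (Fin d → ℝ) |
      ∃ a : ℝ, 0 ≤ a ∧ z.1 + Pi.single j (σ * a) ∈ z.2} := by
  have : {z : (Fin d → ℝ) × Closeds (Fin d → ℝ) |
      ∃ a : ℝ, 0 ≤ a ∧ z.1 + Pi.single j (σ * a) ∈ z.2} = ⋃ n : ℕ,
      {z : (Fin d → ℝ) × Closeds (Fin d → ℝ) |
        ∃ s ∈ Set.Icc (0 : ℝ) n, z.1 + Pi.single j (σ * s) ∈ z.2} := by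
    ext z
    simp only [Set.mem_iUnion]
    constructor
    · rintro ⟨a, ha, h⟩
      obtain ⟨n, hn⟩ := exists_nat_ge a
      exact ⟨n, a, ⟨ha, hn⟩, h⟩
    · rintro ⟨n, a, ha, h⟩
      exact ⟨a, ha.1, h⟩
  rw [this]
  exact MeasurableSet.iUnion fun n => measurableSet_exists_single_mem j σ n

theorem measurable_rayDist {d : ℕ} (j : Fin d) (σ : ℝ) :
    Measurable fun z : (Fin d → ℝ) × Closeds (Fin d → ℝ) => rayDist z.2 z.1 j σ := by
  refine measurable_of_Ioi fun a => ?_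
  rcases lt_or_ge a 0 with ha | ha
  · convert MeasurableSet.univ
    exact Set.eq_univ_of_forall fun z => ha.trans_le rayDist_nonneg
  · convert (measurableSet_exists_ray_mem j σ).inter (measurableSet_exists_single_mem j σ a).compl
    ext z
    by_cases h : ∃ a : ℝ, 0 ≤ a ∧ z.1 + Pi.single j (σ * a) ∈ z.2
    · refine (lt_rayDist_iff h).trans ⟨fun h' => ⟨h, fun ⟨s, hs, hs'⟩ => h' s hs hs'⟩,
        fun h' s hs hs' => h'.2 ⟨s, hs, hs'⟩⟩
    -- On a ray that never hits the set the infimum is over the empty set and equals `0`, so it does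
    -- not exceed `a ≥ 0`.
    · refine ⟨fun h' => ?_, fun h' => absurd h'.1 h⟩
      have h0 : {a : ℝ | 0 ≤ a ∧ z.1 + Pi.single j (σ * a) ∈ z.2} = ∅ :=
        Set.eq_empty_of_forall_notMem fun a ha' => h ⟨a, ha'⟩
      change a < sInf _ at h'
      rw [h0, Real.sInf_empty] at h'
      exact absurd h' ha.not_gt

theorem measurable_extents {d : ℕ} :
    Measurable fun z : (Fin d → ℝ) × Closeds (Fin d → ℝ) => extents z.2 z.1 :=
  measurable_pi_lambda _ fun j => (measurable_rayDist j _).prodMk (measurable_rayDist j _)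

theorem measurable_extents_left {d : ℕ} (p : Fin d → ℝ) :
    Measurable fun F : Closeds (Fin d → ℝ) => extents F p :=
  measurable_extents.comp (measurable_const.prodMk measurable_id)

theorem measurableSet_hasBoxCell {d : ℕ} :
    MeasurableSet {z : (Fin d → ℝ) × Closeds (Fin d → ℝ) | HasBoxCell z.2 z.1} := by
  have hmiss : ∀ {C : Set (Fin d → ℝ)}, IsCompact C →
      MeasurableSet {z : (Fin d → ℝ) × Closeds (Fin d → ℝ) | ∀ y ∈ C, z.1 + y ∉ z.2} := by
    intro C hC
    convert (measurableSet_exists_add_mem hC).compl using 1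
    ext z
    simp only [Set.mem_compl_iff, Set.mem_ofPred_eq, not_exists, not_and]
  have heq : {z : (Fin d → ℝ) × Closeds (Fin d → ℝ) | HasBoxCell z.2 z.1} =
      {z | (∀ y ∈ ({0} : Set (Fin d → ℝ)), z.1 + y ∉ z.2) ∧
        (∀ j, (∃ a : ℝ, 0 ≤ a ∧ z.1 + Pi.single j (-1 * a) ∈ z.2) ∧
          ∃ a : ℝ, 0 ≤ a ∧ z.1 + Pi.single j (1 * a) ∈ z.2) ∧
        ∀ q lo hi : Fin d → ℚ, (∀ j, lo j < hi j) → (∀ j, lo j ≤ q j) → (∀ j, q j ≤ hi j) →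
          (∀ y ∈ axisCross (fun j => (q j : ℝ)) (fun j => (lo j : ℝ)) (fun j => (hi j : ℝ)),
            z.1 + y ∉ z.2) →
          ∀ y ∈ Set.Icc (fun j => (lo j : ℝ)) (fun j => (hi j : ℝ)), z.1 + y ∉ z.2} := by
    ext z
    refine ⟨fun h => ⟨by simpa using h.notMem,
      fun j => ⟨h.ray j (-1) (by simp), h.ray j 1 (by simp)⟩, h.cross⟩,
      fun h => ⟨by simpa using h.1, ?_, h.2.2⟩⟩
    rintro j σ (rfl | rfl)
    · exact (h.2.1 j).1
    · exact (h.2.1 j).2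
  have hall : ∀ {ι : Type} [Countable ι] {r : ι → (Fin d → ℝ) × Closeds (Fin d → ℝ) → Prop},
      (∀ i, MeasurableSet {z | r i z}) → MeasurableSet {z | ∀ i, r i z} := by
    intro ι _ r h
    exact (Measurable.forall fun i => measurableSet_setOfPred.1 (h i)).setOf
  rw [heq]
  refine (hmiss isCompact_singleton).inter (MeasurableSet.inter ?_ ?_)
  · exact hall fun j =>
      (measurableSet_exists_ray_mem j _).inter (measurableSet_exists_ray_mem j _)
  · refine hall fun q => hall fun lo => hall fun hi => (MeasurableSet.const _).imp <|
      (MeasurableSet.const _).imp <| (MeasurableSet.const _).imp ?_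
    exact (hmiss (isCompact_axisCross _ _ _)).imp (hmiss isCompact_Icc)

/-! ### Almost surely the cell of a fixed point is a box -/

theorem add_image_axisCross {d : ℕ} (p q lo hi : Fin d → ℝ) :
    (fun y => p + y) '' axisCross q lo hi = axisCross (p + q) (p + lo) (p + hi) := by
  have key : ∀ (j : Fin d) (s : ℝ),
      p + Function.update q j s = Function.update (p + q) j (p j + s) := by
    intro j s
    ext i
    rcases eq_or_ne i j with rfl | hij
    · simp
    · simp [hij]
  simp only [axisCross, Set.image_iUnion, Set.image_image, key]
  refine Set.iUnion_congr fun j => ?_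
  rw [Pi.add_apply, Pi.add_apply, ← Set.image_const_add_Icc, Set.image_image]

namespace IsMondrian

variable {d : ℕ} {Ω : Type*} [MeasurableSpace Ω] {P : Measure Ω} {l : ℝ}
  {Y : Ω → Closeds (Fin d → ℝ)}

/-- Rational vertices leave only countably many boxes, so the exceptional null sets can be united.
-/
theorem ae_cross (hY : IsMondrian P (l * d) Y) (hd : 0 < d) (hl : 0 < l) (p : Fin d → ℝ) :
    ∀ᵐ ω ∂P, ∀ q lo hi : Fin d → ℚ,
      (∀ j, lo j < hi j) → (∀ j, lo j ≤ q j) → (∀ j, q j ≤ hi j) →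
      (∀ y ∈ axisCross (fun j => (q j : ℝ)) (fun j => (lo j : ℝ)) (fun j => (hi j : ℝ)),
        p + y ∉ Y ω) →
      ∀ y ∈ Set.Icc (fun j => (lo j : ℝ)) (fun j => (hi j : ℝ)), p + y ∉ Y ω := by
  simp only [ae_all_iff]
  intro q lo hi hlohi hlo hhi
  filter_upwards [hY.ae_misses_box hd (by positivity)
    (q := p + fun j => (q j : ℝ)) (lo := p + fun j => (lo j : ℝ)) (hi := p + fun j => (hi j : ℝ))
    (fun j => by simpa using hlohi j) (fun j => by simpa using hlo j)
    (fun j => by simpa using hhi j)] with ω hω hcross y hy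
  refine hω ?_ (p + y) ⟨fun j => by simpa using hy.1 j, fun j => by simpa using hy.2 j⟩
  rw [← add_image_axisCross]
  rintro _ ⟨z, hz, rfl⟩
  exact hcross z hz

theorem measurableSet_misses_add (hY : IsMondrian P (l * d) Y) (p : Fin d → ℝ)
    {C : Set (Fin d → ℝ)} (hC : IsCompact C) : MeasurableSet {ω | ∀ y ∈ C, p + y ∉ Y ω} := by
  have := hY.measurableSet_misses
    (hC.image (continuous_const.add continuous_id) : IsCompact ((fun y => p + y) '' C))
  simpa only [Set.forall_mem_image] using this

theorem measure_misses_cross_of_pos (hY : IsMondrian P (l * d) Y) (hd : 0 < d) (hl : 0 < l)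
    (p : Fin d → ℝ) {a b : Fin d → ℝ} (ha : ∀ j, 0 < a j) (hb : ∀ j, 0 < b j) :
    P {ω | ∀ y ∈ axisCross 0 (-a) b, p + y ∉ Y ω}
      = ENNReal.ofReal (Real.exp (-(l * ∑ j, (a j + b j)))) := by
  have hset : {ω | ∀ y ∈ axisCross 0 (-a) b, p + y ∉ Y ω}
      = {ω | ∀ y ∈ axisCross (p + 0) (p + -a) (p + b), y ∉ Y ω} := by
    simp only [← add_image_axisCross, Set.forall_mem_image]
  have h1 : p + -a ≤ p + 0 := fun j => by simpa using (ha j).le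
  have h2 : p + 0 ≤ p + b := fun j => by simpa using (hb j).le
  rw [hset, hY.measure_misses hd (by positivity) (fun j => ?_) h1 h2 subset_rfl
    (axisCross_subset_Icc h1 h2) (isCompact_axisCross _ _ _)]
  · have hd' : (d : ℝ) ≠ 0 := by exact_mod_cast hd.ne'
    -- The factor `d` of the lifetime cancels the `1 / d` in the intensity measure.
    congr 3
    rw [← mul_assoc, mul_assoc l, mul_one_div_cancel hd', mul_one]
    congr 1
    exact Finset.sum_congr rfl fun j _ => by simp; ring
  · have := ha j
    have := hb j
    simp only [Pi.add_apply, Pi.neg_apply]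
    linarith

/-- Windows must be nondegenerate, but arms of length zero are needed for single points, single rays
and nonpositive thresholds. A compact cross misses a closed set exactly when some slightly longer
cross does, so the formula passes to the limit by continuity from below. -/
theorem measure_misses_cross (hY : IsMondrian P (l * d) Y) (hd : 0 < d) (hl : 0 < l)
    (p : Fin d → ℝ) {a b : Fin d → ℝ} (ha : ∀ j, 0 ≤ a j) (hb : ∀ j, 0 ≤ b j) :
    P {ω | ∀ y ∈ axisCross 0 (-a) b, p + y ∉ Y ω}
      = ENNReal.ofReal (Real.exp (-(l * ∑ j, (a j + b j)))) := by
  let ε : ℕ → ℝ := fun k => 1 / ((k : ℝ) + 1)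
  have hε : ∀ k, 0 < ε k := fun k => by positivity
  have hεanti : Antitone ε := fun m n hmn => Nat.one_div_le_one_div hmn
  have hεlim : Tendsto ε atTop (𝓝 0) := tendsto_one_div_add_atTop_nhds_zero_nat
  let M : ℕ → Set Ω := fun k =>
    {ω | ∀ y ∈ axisCross 0 (-fun j => a j + ε k) (fun j => b j + ε k), p + y ∉ Y ω}
  have hcross : ∀ {a b a' b' : Fin d → ℝ}, (∀ j, a' j ≤ a j) → (∀ j, b j ≤ b' j) →
      axisCross 0 a b ⊆ axisCross 0 a' b' := fun h1 h2 =>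
    Set.iUnion_mono fun j => Set.image_mono (Set.Icc_subset_Icc (h1 j) (h2 j))
  have hmono : Monotone M := fun m n hmn ω hω y hy => hω y (hcross
    (fun j => by simp [hεanti hmn]) (fun j => by simp [hεanti hmn]) hy)
  have hUnion : ⋃ k, M k = {ω | ∀ y ∈ axisCross 0 (-a) b, p + y ∉ Y ω} := by
    ext ω
    rw [Set.mem_iUnion]
    constructor
    · rintro ⟨k, hk⟩ y hy
      exact hk y (hcross (fun j => by simp [(hε k).le]) (fun j => by simp [(hε k).le]) hy)
    · intro h
      have hopen : IsOpen {y : Fin d → ℝ | p + y ∉ Y ω} :=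
        (Y ω).isClosed.isOpen_compl.preimage (continuous_const.add continuous_id)
      obtain ⟨δ, hδ, hthick⟩ :=
        (isCompact_axisCross 0 (-a) b).exists_cthickening_subset_open hopen h
      obtain ⟨k, hk⟩ := exists_nat_one_div_lt hδ
      refine ⟨k, fun y hy => hthick ?_⟩
      obtain ⟨j, s, hs, rfl⟩ := Set.mem_iUnion.1 hy
      have hs1 : -(a j + ε k) ≤ s := hs.1
      have hs2 : s ≤ b j + ε k := hs.2
      have hεk : ε k < δ := hk
      have ha' := ha j
      have hb' := hb j
      -- The nearby point of the shorter cross is obtained by clamping `s` to `[-a j, b j]`.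
      refine Metric.mem_cthickening_of_dist_le _
        (Function.update (0 : Fin d → ℝ) j (max (-a j) (min (b j) s))) _ _
        (Set.mem_iUnion.2 ⟨j, _, ⟨le_max_left _ _, max_le ?_ (min_le_left _ _)⟩, rfl⟩) ?_
      · change -a j ≤ b j
        linarith
      · rw [dist_pi_le_iff hδ.le]
        intro i
        rcases eq_or_ne i j with rfl | hij
        · simp only [Function.update_self, Real.dist_eq, abs_le]
          rcases max_cases (-a i) (min (b i) s) with h | h <;>
            rcases min_cases (b i) s with h' | h' <;> constructor <;> linarith
        · simpa [hij] using hδ.le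
  have hlim1 := tendsto_measure_iUnion_atTop (μ := P) hmono
  rw [hUnion] at hlim1
  have hMk : ∀ k, P (M k)
      = ENNReal.ofReal (Real.exp (-(l * ∑ j, (a j + ε k + (b j + ε k))))) := fun k =>
    hY.measure_misses_cross_of_pos hd hl p (a := fun j => a j + ε k) (b := fun j => b j + ε k)
      (fun j => by linarith [ha j, hε k]) (fun j => by linarith [hb j, hε k])
  have hlim2 : Tendsto (fun k => P (M k)) atTop
      (𝓝 (ENNReal.ofReal (Real.exp (-(l * ∑ j, (a j + 0 + (b j + 0))))))) := by
    simp only [hMk]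
    refine ENNReal.tendsto_ofReal ((Real.continuous_exp.tendsto _).comp ?_)
    refine (Tendsto.const_mul l (tendsto_finsetSum _ fun j _ => ?_)).neg
    exact (hεlim.const_add _).add (hεlim.const_add _)
  simpa using tendsto_nhds_unique hlim1 hlim2

/-- A cross reduced to one arm of length `n` along the ray is missed with probability `e^{-ln}`,
which tends to `0`. -/
theorem ae_ray (hY : IsMondrian P (l * d) Y) (hd : 0 < d) (hl : 0 < l) (p : Fin d → ℝ) (j : Fin d)
    {σ : ℝ} (hσ : σ ∈ ({-1, 1} : Set ℝ)) :
    ∀ᵐ ω ∂P, ∃ a : ℝ, 0 ≤ a ∧ p + Pi.single j (σ * a) ∈ Y ω := by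
  have hbound : ∀ n : ℕ, P {ω | ¬ ∃ a : ℝ, 0 ≤ a ∧ p + Pi.single j (σ * a) ∈ Y ω}
      ≤ ENNReal.ofReal (Real.exp (-(l * n))) := by
    intro n
    have key : ∀ a b : Fin d → ℝ, (∀ i, 0 ≤ a i) → (∀ i, 0 ≤ b i) → ∑ i, (a i + b i) = n →
        (∀ i, ∀ s ∈ Set.Icc (-a i) (b i), ∃ r : ℝ, 0 ≤ r ∧
          (Function.update 0 i s : Fin d → ℝ) = Pi.single j (σ * r)) →
        P {ω | ¬ ∃ a : ℝ, 0 ≤ a ∧ p + Pi.single j (σ * a) ∈ Y ω}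
          ≤ ENNReal.ofReal (Real.exp (-(l * n))) := by
      intro a b ha hb hsum hcross
      rw [← hsum, ← hY.measure_misses_cross hd hl p ha hb]
      refine measure_mono fun ω hω y hy hmem => hω ?_
      obtain ⟨i, s, hs, rfl⟩ := Set.mem_iUnion.1 hy
      obtain ⟨r, hr, hr'⟩ := hcross i s hs
      exact ⟨r, hr, hr' ▸ hmem⟩
    have hsingle : ∀ i, 0 ≤ (Pi.single j (n : ℝ) : Fin d → ℝ) i := fun i => by
      rcases eq_or_ne i j with rfl | hij
      · simp
      · simp [hij]
    rcases hσ with rfl | rfl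
    · refine key (Pi.single j (n : ℝ)) 0 hsingle (fun i => le_rfl) (by simp) ?_
      intro i s hs
      rcases eq_or_ne i j with rfl | hij
      · exact ⟨-s, by simpa using hs.2, by simp [Pi.single]⟩
      · have : s = 0 := by simpa [hij] using hs
        exact ⟨0, le_rfl, by simp [this]⟩
    · refine key 0 (Pi.single j (n : ℝ)) (fun i => le_rfl) hsingle (by simp) ?_
      intro i s hs
      rcases eq_or_ne i j with rfl | hij
      · exact ⟨s, by simpa using hs.1, by simp [Pi.single]⟩
      · have : s = 0 := by simpa [hij] using hs
        exact ⟨0, le_rfl, by simp [this]⟩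
  rw [ae_iff]
  refine le_antisymm (ge_of_tendsto' (x := atTop) ?_ hbound) bot_le
  rw [← ENNReal.ofReal_zero]
  refine ENNReal.tendsto_ofReal (Real.tendsto_exp_neg_atTop_nhds_zero.comp ?_)
  exact tendsto_natCast_atTop_atTop.const_mul_atTop hl

/-- The cross with all arms of length zero is the point itself, and it is missed with probability
`e^0 = 1`. -/
theorem ae_notMem [IsProbabilityMeasure P] (hY : IsMondrian P (l * d) Y) (hd : 0 < d) (hl : 0 < l)
    (p : Fin d → ℝ) : ∀ᵐ ω ∂P, p ∉ Y ω := by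
  have h := hY.measure_misses_cross hd hl p (a := 0) (b := 0) (fun _ => le_rfl) (fun _ => le_rfl)
  have hm := hY.measurableSet_misses_add p (isCompact_axisCross 0 (-0) 0)
  simp only [Pi.zero_apply, add_zero, Finset.sum_const_zero, mul_zero, neg_zero, Real.exp_zero,
    ENNReal.ofReal_one] at h hm
  filter_upwards [(prob_compl_eq_zero_iff hm).2 h] with ω hω
  have h0 : (0 : Fin d → ℝ) ∈ axisCross 0 0 0 :=
    Set.mem_iUnion.2 ⟨⟨0, hd⟩, 0, by simp, by simp⟩
  simpa using hω 0 h0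

theorem ae_hasBoxCell [IsProbabilityMeasure P] (hY : IsMondrian P (l * d) Y) (hd : 0 < d)
    (hl : 0 < l) (p : Fin d → ℝ) : ∀ᵐ ω ∂P, HasBoxCell (Y ω) p := by
  have hray : ∀ᵐ ω ∂P, ∀ j, (∃ a : ℝ, 0 ≤ a ∧ p + Pi.single j (-1 * a) ∈ Y ω) ∧
      ∃ a : ℝ, 0 ≤ a ∧ p + Pi.single j (1 * a) ∈ Y ω :=
    ae_all_iff.2 fun j => (hY.ae_ray hd hl p j (by simp)).and (hY.ae_ray hd hl p j (by simp))
  filter_upwards [hY.ae_notMem hd hl p, hray, hY.ae_cross hd hl p] with ω h1 h2 h3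
  refine ⟨h1, ?_, h3⟩
  rintro j σ (rfl | rfl)
  · exact (h2 j).1
  · exact (h2 j).2

end IsMondrian

/-! ### The law of the extents -/

/-- This turns the probabilities of missing crosses into the joint survival function of the extents.
-/
theorem HasBoxCell.misses_cross_iff {d : ℕ} {F : Closeds (Fin d → ℝ)} {p : Fin d → ℝ}
    (h : HasBoxCell F p) {a b : Fin d → ℝ} (ha : ∀ j, 0 ≤ a j) (hb : ∀ j, 0 ≤ b j) :
    (∀ y ∈ axisCross 0 (-a) b, p + y ∉ F)
      ↔ ∀ j, a j < (extents F p j).1 ∧ b j < (extents F p j).2 := by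
  constructor
  · intro hmiss j
    have hmem : ∀ s ∈ Set.Icc (-a j) (b j), p + Pi.single j s ∉ F := fun s hs =>
      hmiss _ (Set.mem_iUnion.2 ⟨j, s, hs, rfl⟩)
    refine ⟨(lt_rayDist_iff (h.ray j (-1) (by simp))).2 fun s hs => hmem _ ⟨?_, ?_⟩,
      (lt_rayDist_iff (h.ray j 1 (by simp))).2 fun s hs => hmem _ ⟨?_, ?_⟩⟩ <;>
    linarith [hs.1, hs.2, ha j, hb j]
  · intro hlt y hy
    obtain ⟨j, s, hs, rfl⟩ := Set.mem_iUnion.1 hy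
    exact notMem_of_axis (by have : -a j ≤ s := hs.1; linarith [(hlt j).1])
      (hs.2.trans_lt (hlt j).2)

theorem expMeasure_Ioi_eq_max {l : ℝ} (hl : 0 < l) (a : ℝ) :
    expMeasure l (Set.Ioi a) = ENNReal.ofReal (Real.exp (-(l * max a 0))) := by
  rw [← expMeasure_Ioi hl (le_max_right a 0)]
  refine measure_congr (eventuallyEq_set.2 ?_)
  filter_upwards [ae_pos_expMeasure hl] with x hx
  simp [hx]

theorem isCountablySpanning_range_Ioi : IsCountablySpanning (Set.range (Set.Ioi : ℝ → Set ℝ)) := by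
  refine ⟨fun n : ℕ => Set.Ioi (-(n : ℝ)), fun n => ⟨_, rfl⟩, Set.eq_univ_of_forall fun x => ?_⟩
  obtain ⟨n, hn⟩ := exists_nat_gt (-x)
  exact Set.mem_iUnion.2 ⟨n, by simp only [Set.mem_Ioi]; linarith⟩

/-- The law of the extents of a cell: independent exponential variables. -/
theorem IsMondrian.map_extents {d : ℕ} {Ω : Type*} [MeasurableSpace Ω] {P : Measure Ω}
    [IsProbabilityMeasure P] {l : ℝ} {Y : Ω → Closeds (Fin d → ℝ)}
    (hY : IsMondrian P (l * d) Y) (hd : 0 < d) (hl : 0 < l) (p : Fin d → ℝ) :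
    P.map (fun ω => extents (Y ω) p)
      = Measure.pi fun _ : Fin d => (expMeasure l).prod (expMeasure l) := by
  have : IsProbabilityMeasure (expMeasure l) := isProbabilityMeasure_expMeasure hl
  have hmeas : Measurable fun ω => extents (Y ω) p := (measurable_extents_left p).comp hY.1
  have hgen : MeasurableSpace.generateFrom (Set.range (Set.Ioi : ℝ → Set ℝ))
      = (inferInstance : MeasurableSpace ℝ) := by
    rw [← borel_eq_generateFrom_Ioi]
    exact BorelSpace.measurable_eq.symm
  have hpi : IsPiSystem (Set.range (Set.Ioi : ℝ → Set ℝ)) := isPiSystem_Ioi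
  let S : (expMeasure l).FiniteSpanningSetsIn (Set.range (Set.Ioi : ℝ → Set ℝ)) :=
    { set := isCountablySpanning_range_Ioi.choose
      set_mem := isCountablySpanning_range_Ioi.choose_spec.1
      finite := fun _ => measure_lt_top _ _
      spanning := isCountablySpanning_range_Ioi.choose_spec.2 }
  -- Products of open half-lines form a generating π-system, so it suffices to compare joint
  -- survival functions.
  refine (Measure.pi_eq_generateFrom
    (C := fun _ => Set.image2 (· ×ˢ ·) (Set.range Set.Ioi) (Set.range Set.Ioi))
    (fun _ => generateFrom_eq_prod hgen hgen isCountablySpanning_range_Ioi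
      isCountablySpanning_range_Ioi) (fun _ => hpi.prod hpi) (fun _ => S.prod S) ?_).symm
  intro s hs
  have hs' : ∀ j, ∃ a b : ℝ, s j = Set.Ioi a ×ˢ Set.Ioi b := by
    intro j
    obtain ⟨_, ⟨a, rfl⟩, _, ⟨b, rfl⟩, h⟩ := hs j
    exact ⟨a, b, h.symm⟩
  choose a b hab using hs'
  obtain rfl : s = fun j => Set.Ioi (a j) ×ˢ Set.Ioi (b j) := funext hab
  rw [Measure.map_apply hmeas (MeasurableSet.univ_pi fun j =>
    measurableSet_Ioi.prod measurableSet_Ioi)]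
  -- The extents are almost surely positive, so a negative threshold may be replaced by `0`.
  have hset : (fun ω => extents (Y ω) p) ⁻¹'
        Set.univ.pi (fun j => Set.Ioi (a j) ×ˢ Set.Ioi (b j)) =ᵐ[P]
      {ω | ∀ y ∈ axisCross 0 (-fun j => max (a j) 0) (fun j => max (b j) 0), p + y ∉ Y ω} := by
    refine eventuallyEq_set.2 ?_
    filter_upwards [hY.ae_hasBoxCell hd hl p] with ω hω
    refine Iff.trans ?_
      (hω.misses_cross_iff (fun j => le_max_right _ _) (fun j => le_max_right _ _)).symm
    simp [Set.mem_pi, hω.fst_extents_pos, hω.snd_extents_pos]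
  rw [measure_congr hset, hY.measure_misses_cross hd hl p (fun j => le_max_right _ _)
    (fun j => le_max_right _ _)]
  simp only [Measure.prod_prod, expMeasure_Ioi_eq_max hl]
  rw [Finset.mul_sum, ← Finset.sum_neg_distrib, Real.exp_sum,
    ENNReal.ofReal_prod_of_nonneg fun _ _ => (Real.exp_pos _).le]
  refine Finset.prod_congr rfl fun j _ => ?_
  rw [← ENNReal.ofReal_mul (Real.exp_pos _).le, ← Real.exp_add]
  congr 2
  ring

/-! ### Expectation of the tree estimator and the limit of the forest -/

/-- The density at `x` of the uniform distribution on the cell of `p`, in terms of the extents of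
this cell. -/
def boxDensity {d : ℕ} (F : Closeds (Fin d → ℝ)) (p x : Fin d → ℝ) : ℝ :=
  ∏ j, intervalDensity (x j - p j) (extents F p j)

theorem treeEstimator_eq {d n : ℕ} {F : Closeds (Fin d → ℝ)} {p : Fin n → Fin d → ℝ}
    (h : ∀ i, HasBoxCell F (p i)) (x : Fin d → ℝ) :
    treeEstimator F p x = (1 / n : ℝ) * ∑ i, boxDensity F (p i) x := by
  simp only [treeEstimator, boxDensity, (h _).indicator_cellAt]

theorem measurable_boxDensity {d : ℕ} {α : Type*} [MeasurableSpace α] {g : α → Closeds (Fin d → ℝ)}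
    {q : α → Fin d → ℝ} (hg : Measurable g) (hq : Measurable q) (x : Fin d → ℝ) :
    Measurable fun a => boxDensity (g a) (q a) x := by
  have hext : Measurable fun a => extents (g a) (q a) := measurable_extents.comp (hq.prodMk hg)
  refine Finset.measurable_prod _ fun j _ =>
    measurable_uncurry_intervalDensity.comp (Measurable.prodMk ?_ ?_)
  · exact measurable_const.sub ((measurable_pi_apply j).comp hq)
  · exact (measurable_pi_apply j).comp hext

theorem kernelDensityEstimator_eq {d n : ℕ} {l : ℝ} (p : Fin n → Fin d → ℝ) (x : Fin d → ℝ) :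
    kernelDensityEstimator K₀ l⁻¹ p x
      = (1 / n : ℝ) * ∑ i, l ^ d * K₀ (l • (x - p i)) := by
  simp only [kernelDensityEstimator, inv_inv, ← Finset.mul_sum, ← mul_assoc]
  congr 1
  rw [inv_pow, one_div, one_div, mul_inv, inv_inv]

theorem measurable_kernelDensityEstimator {d n : ℕ} (b : ℝ) (x : Fin d → ℝ) :
    Measurable fun p : Fin n → Fin d → ℝ => kernelDensityEstimator K₀ b p x := by
  refine Measurable.const_mul (Finset.measurable_sum _ fun i _ => (measurable_K₀ d).comp ?_) _
  have hi : Measurable fun p : Fin n → Fin d → ℝ => p i := measurable_pi_apply i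
  exact (measurable_const.sub hi).const_smul b⁻¹

namespace IsMondrian

variable {d n : ℕ} {Ω : Type*} [MeasurableSpace Ω] {P : Measure Ω} [IsProbabilityMeasure P]
  {l : ℝ}

section

variable {Y : Ω → Closeds (Fin d → ℝ)}

/-- Under the product law of the extents the integral of the product splits into one-dimensional
integrals, each equal to `l` times a factor of `K₀`. -/
theorem integrable_boxDensity (hY : IsMondrian P (l * d) Y) (hd : 0 < d) (hl : 0 < l)
    (p x : Fin d → ℝ) :
    Integrable (fun ω => boxDensity (Y ω) p x) P ∧
      ∫ ω, boxDensity (Y ω) p x ∂P = l ^ d * K₀ (l • (x - p)) := by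
  have : IsProbabilityMeasure (expMeasure l) := isProbabilityMeasure_expMeasure hl
  have hext : AEMeasurable (fun ω => extents (Y ω) p) P :=
    ((measurable_extents_left p).comp hY.1).aemeasurable
  have hprod : Integrable (fun e : Fin d → ℝ × ℝ =>
      ∏ j, intervalDensity (x j - p j) (e j)) (P.map fun ω => extents (Y ω) p) := by
    rw [hY.map_extents hd hl]
    exact Integrable.fintype_prod (f := fun j => intervalDensity (x j - p j))
      fun j => (integrable_intervalDensity hl _).1
  refine ⟨hprod.comp_aemeasurable hext, ?_⟩
  simp only [boxDensity]
  rw [← integral_map hext hprod.aestronglyMeasurable, hY.map_extents hd hl,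
    integral_fintype_prod_eq_prod fun j => intervalDensity (x j - p j),
    Finset.prod_congr rfl fun j _ => (integrable_intervalDensity hl _).2]
  simp [Finset.prod_mul_distrib, K₀_eq_prod]

theorem integrable_treeEstimator (hY : IsMondrian P (l * d) Y) (hd : 0 < d) (hl : 0 < l)
    (p : Fin n → Fin d → ℝ) (x : Fin d → ℝ) :
    Integrable (fun ω => treeEstimator (Y ω) p x) P ∧
      idealForestEstimator P Y p x = kernelDensityEstimator K₀ l⁻¹ p x := by
  have h : (fun ω => treeEstimator (Y ω) p x) =ᵐ[P]
      fun ω => (1 / n : ℝ) * ∑ i, boxDensity (Y ω) (p i) x := by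
    filter_upwards [ae_all_iff.2 fun i => hY.ae_hasBoxCell hd hl (p i)] with ω hω
    exact treeEstimator_eq hω x
  have hint := fun i => hY.integrable_boxDensity hd hl (p i) x
  refine ⟨((integrable_finsetSum _ fun i _ => (hint i).1).const_mul _).congr h.symm, ?_⟩
  rw [idealForestEstimator, integral_congr_ae h, integral_const_mul,
    integral_finsetSum _ fun i _ => (hint i).1, kernelDensityEstimator_eq,
    Finset.sum_congr rfl fun i _ => (hint i).2]

end

variable {Y : ℕ → Ω → Closeds (Fin d → ℝ)}

theorem ae_tendsto_boxDensity (hY : ∀ m, IsMondrian P (l * d) (Y m)) (hind : iIndepFun Y P)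
    (hd : 0 < d) (hl : 0 < l) (p x : Fin d → ℝ) :
    ∀ᵐ ω ∂P, Tendsto (fun M : ℕ => (∑ m ∈ Finset.range M, boxDensity (Y m ω) p x) / M) atTop
      (𝓝 (l ^ d * K₀ (l • (x - p)))) := by
  have hm := measurable_boxDensity measurable_id (measurable_const (a := p)) x
  rw [← ((hY 0).integrable_boxDensity hd hl p x).2]
  refine strong_law_ae_real (fun m ω => boxDensity (Y m ω) p x)
    ((hY 0).integrable_boxDensity hd hl p x).1
    (fun i j hij => (hind.indepFun hij).comp hm hm) fun m => ?_
  -- The summand depends on the tree only through the extents, whose law is already known; equality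
  -- in law of the whole closed sets is not needed.
  have hext : IdentDistrib (fun ω => extents (Y m ω) p) (fun ω => extents (Y 0 ω) p) P P :=
    { aemeasurable_fst := ((measurable_extents_left p).comp (hY m).1).aemeasurable
      aemeasurable_snd := ((measurable_extents_left p).comp (hY 0).1).aemeasurable
      map_eq := by rw [(hY m).map_extents hd hl, (hY 0).map_extents hd hl] }
  exact hext.comp (u := fun e : Fin d → ℝ × ℝ => ∏ j, intervalDensity (x j - p j) (e j))
    (Finset.measurable_prod _ fun j _ =>
      (measurable_intervalDensity _).comp (measurable_pi_apply j))

/-- The forest estimator converges almost surely, if the data are fixed. -/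
theorem ae_tendsto_forest (hY : ∀ m, IsMondrian P (l * d) (Y m)) (hind : iIndepFun Y P)
    (hd : 0 < d) (hl : 0 < l) (p : Fin n → Fin d → ℝ) (x : Fin d → ℝ) :
    ∀ᵐ ω ∂P, Tendsto (fun M : ℕ => (1 / M : ℝ) * ∑ m ∈ Finset.range M,
      ((1 / n : ℝ) * ∑ i, boxDensity (Y m ω) (p i) x)) atTop
      (𝓝 (kernelDensityEstimator K₀ l⁻¹ p x)) := by
  filter_upwards [ae_all_iff.2 fun i => ae_tendsto_boxDensity hY hind hd hl (p i) x] with ω hω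
  rw [kernelDensityEstimator_eq]
  refine ((tendsto_finsetSum Finset.univ fun i _ => hω i).const_mul (1 / n : ℝ)).congr fun M => ?_
  rw [← Finset.mul_sum, Finset.sum_comm, ← Finset.sum_div]
  ring

/-- The forest estimator converges almost surely, if the data are independent of the trees. -/
theorem ae_tendsto_forestEstimator (hY : ∀ m, IsMondrian P (l * d) (Y m)) (hind : iIndepFun Y P)
    (hd : 0 < d) (hl : 0 < l) {X : Fin n → Ω → Fin d → ℝ} (hX : ∀ i, Measurable (X i))
    (hXY : IndepFun (fun ω i => X i ω) (fun ω m => Y m ω) P) (x : Fin d → ℝ) :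
    ∀ᵐ ω ∂P, Tendsto
      (fun M : ℕ => forestEstimator (fun m => Y m ω) M (fun i => X i ω) x) atTop
      (𝓝 (kernelDensityEstimator K₀ l⁻¹ (fun i => X i ω) x)) := by
  -- The good event is phrased through `HasBoxCell` and `boxDensity`, which are jointly measurable,
  -- instead of `cellAt`. Subtracting the limit makes it constant, so that convergence is a
  -- measurable event.
  let E : Set ((Fin n → Fin d → ℝ) × (ℕ → Closeds (Fin d → ℝ))) :=
    {z | (∀ (m : ℕ) (i : Fin n), HasBoxCell (z.2 m) (z.1 i)) ∧
      Tendsto (fun M : ℕ => (1 / M : ℝ) * ∑ m ∈ Finset.range M,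
        ((1 / n : ℝ) * ∑ i, boxDensity (z.2 m) (z.1 i) x) - kernelDensityEstimator K₀ l⁻¹ z.1 x)
        atTop (𝓝 0)}
  have hpair : ∀ (m : ℕ) (i : Fin n), Measurable
      fun z : (Fin n → Fin d → ℝ) × (ℕ → Closeds (Fin d → ℝ)) => (z.1 i, z.2 m) := fun m i =>
    ((measurable_pi_apply i).comp measurable_fst).prodMk
      ((measurable_pi_apply m).comp measurable_snd)
  have hcell : ∀ (m : ℕ) (i : Fin n), MeasurableSet
      {z : (Fin n → Fin d → ℝ) × (ℕ → Closeds (Fin d → ℝ)) | HasBoxCell (z.2 m) (z.1 i)} :=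
    fun m i => hpair m i measurableSet_hasBoxCell
  have hdens : ∀ (m : ℕ) (i : Fin n), Measurable
      fun z : (Fin n → Fin d → ℝ) × (ℕ → Closeds (Fin d → ℝ)) => boxDensity (z.2 m) (z.1 i) x :=
    fun m i => measurable_boxDensity (hpair m i).snd (hpair m i).fst x
  have hE : MeasurableSet E := by
    refine MeasurableSet.inter ?_ (measurableSet_tendsto _ fun M => ?_)
    · exact (Measurable.forall fun m => Measurable.forall fun i =>
        measurableSet_setOfPred.1 (hcell m i)).setOf
    · refine Measurable.sub (Measurable.const_mul ?_ _)
        ((measurable_kernelDensityEstimator _ x).comp measurable_fst)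
      refine Finset.measurable_sum _ fun m _ => Measurable.const_mul ?_ _
      exact Finset.measurable_sum _ fun i _ => hdens m i
  have hXm : Measurable fun ω i => X i ω := measurable_pi_lambda _ hX
  have hYm : Measurable fun ω m => Y m ω := measurable_pi_lambda _ fun m => (hY m).1
  have hprob := Measure.isProbabilityMeasure_map (μ := P) hXm.aemeasurable
  have hprob' := Measure.isProbabilityMeasure_map (μ := P) hYm.aemeasurable
  have hae : ∀ᵐ z ∂(P.map fun ω => ((fun i => X i ω), fun m => Y m ω)), z ∈ E := by
    -- By independence the joint law of data and trees is a product, so by Fubini it is enough to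
    -- treat each fixed value `p` of the data.
    rw [(indepFun_iff_map_prod_eq_prod_map_map hXm.aemeasurable hYm.aemeasurable).1 hXY]
    refine (Measure.ae_prod_iff_ae_ae (p := fun z => z ∈ E) hE).2 (Eventually.of_forall fun p => ?_)
    have hEp : MeasurableSet {F : ℕ → Closeds (Fin d → ℝ) | (p, F) ∈ E} :=
      measurable_prodMk_left hE
    refine (ae_map_iff hYm.aemeasurable hEp).2 ?_
    filter_upwards [ae_tendsto_forest hY hind hd hl p x, ae_all_iff.2 fun m => ae_all_iff.2
      fun i => (hY m).ae_hasBoxCell hd hl (p i)] with ω h1 h2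
    exact ⟨h2, tendsto_sub_nhds_zero_iff.2 h1⟩
  filter_upwards [ae_of_ae_map (hXm.prodMk hYm).aemeasurable hae] with ω hω
  refine (tendsto_sub_nhds_zero_iff.1 hω.2).congr fun M => ?_
  simp only [forestEstimator]
  congr 1
  exact Finset.sum_congr rfl fun m _ => (treeEstimator_eq (hω.1 m) x).symm

end IsMondrian

end Mondrian

end

theorem mainTheorem11
    (d n : ℕ) (hd : 0 < d) (hn : 0 < n) (lam : ℝ) (hlam : 0 < lam)
    {Ω : Type*} [MeasurableSpace Ω] (P : Measure Ω) [IsProbabilityMeasure P]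
    -- the data: `n` i.i.d. points with density `f`
    (f : (Fin d → ℝ) → ℝ) (hf : Measurable f) (hf_nonneg : ∀ x, 0 ≤ f x)
    (X : Fin n → Ω → (Fin d → ℝ)) (hX : ∀ i, Measurable (X i))
    (hX_indep : iIndepFun X P)
    (hX_law : ∀ i, P.map (X i) = volume.withDensity fun x => ENNReal.ofReal (f x))
    -- the trees: i.i.d. Mondrian processes of lifetime `lam * d`, independent of the data
    (Y : ℕ → Ω → TopologicalSpace.Closeds (Fin d → ℝ))
    (hY : ∀ m, Mondrian.IsMondrian P (lam * d) (Y m))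
    (hY_indep : iIndepFun Y P)
    (hXY_indep : IndepFun (fun ω i => X i ω) (fun ω m => Y m ω) P) :
    -- `K₀` is a kernel: a symmetric probability density
    ((∀ x : Fin d → ℝ, 0 ≤ Mondrian.K₀ x) ∧
      (∀ x : Fin d → ℝ, Mondrian.K₀ (-x) = Mondrian.K₀ x) ∧
      Integrable (Mondrian.K₀ : (Fin d → ℝ) → ℝ) volume ∧
      ∫ x : Fin d → ℝ, Mondrian.K₀ x = 1) ∧
    -- the ideal forest estimator is the kernel density estimator with kernel `K₀` and
    -- bandwidth `1 / lam`
    (∀ (m : ℕ) (p : Fin n → Fin d → ℝ) (x : Fin d → ℝ),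
      Integrable (fun ω => Mondrian.treeEstimator (Y m ω) p x) P ∧
      Mondrian.idealForestEstimator P (Y m) p x
        = Mondrian.kernelDensityEstimator Mondrian.K₀ lam⁻¹ p x) ∧
    -- the forest estimators with `M` trees converge to it almost surely as `M → ∞`
    (∀ x : Fin d → ℝ, ∀ᵐ ω ∂P,
      Tendsto
        (fun M : ℕ => Mondrian.forestEstimator (fun m => Y m ω) M (fun i => X i ω) x)
        atTop
        (𝓝 (Mondrian.kernelDensityEstimator Mondrian.K₀ lam⁻¹ (fun i => X i ω) x))) := by
  refine ⟨⟨Mondrian.K₀_nonneg, Mondrian.K₀_neg, Mondrian.integrable_K₀ d⟩, fun m p x => ?_,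
    fun x => ?_⟩
  · exact (hY m).integrable_treeEstimator hd hlam p x
  · exact Mondrian.IsMondrian.ae_tendsto_forestEstimator hY hY_indep hd hlam hX hXY_indep x
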